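/- Let $(M,g)$ be a complete Riemannian manifold without boundary which is also a complex manifold, with complex structure $J$ satisfying $J^*=-J$. Let a compact Lie group $G$ with Lie algebra $\mathfrak g$ act smoothly on $M$ by holomorphic maps, and fix a $G$-invariant scalar product $\langle\cdot,\cdot\rangle$ on $\mathfrak g^*$, with induced isomorphism $\psi:\mathfrak g^*\to\mathfrak g$, $\xi(\psi(\eta))=\langle \xi,\eta\rangle$ (and the corresponding norm on $\mathfrak g$). For $u\in\mathfrak g$ let $u_M(x)=\frac{d}{dt}\big|_{t=0}\exp(tu)\cdot x$. Assume that $(M,g)$ is a *tamed asymptotically Kähler manifold*: there is a $G$-invariant compact set $K\subset M$ such that on $M\setminus K$ the metric $g$ is Kähler with Kähler form $\omega$, $\omega(u,Jv)=g(u,v)$, the group $G$ acts by isometries, and there is a smooth $G$-equivariant moment map $\mu$ with $d\langle\mu,u\rangle=\iota(u_M)\omega$ for all $u\in\mathfrak g$; extending $\mu$ to $M$ in any way, $\mu$ is proper, i.e. $\mu(x)\to\infty$ as $x\to\infty$ in $M$; and the vector field $v=-J\nabla\big(|\mu|^2/2\big)$ does not vanish outside a compact set. Let $E$ be a $G$-equivariant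 holomorphic vector bundle over $M$ with a smooth Hermitian metric $h^E$ and a smooth $G$-invariant connection $\nabla^E$ with $(\nabla^E)^{0,1}=\bar\partial$. Let $\mathcal E=E\otimes\Lambda^\bullet(T^{0,1}M)^*$ with the metric and connection $\nabla^{\mathcal E}$ induced by $h^E$, $g$, $\nabla^E$ and the Levi-Civita connection $\nabla^{LC}$ (on the part of $M$ where $g$ is Kähler). For $u\in\mathfrak g$ put $\mu^{\mathcal E}(u)=\nabla^{\mathcal E}_{u_M}-\mathcal L^{\mathcal E}_u\in\operatorname{End}\mathcal E$, where $\mathcal L^{\mathcal E}_u$ is the infinitesimal action on sections, $(\mathcal L^{\mathcal E}_u\sigma)(x)=\frac{d}{dt}\big|_{t=0}\exp(-tu)\,\sigma(\exp(tu)x)$. With $\mathbf v=\psi(\mu)$ set $$\nu=|\mathbf v|+\|\nabla^{LC}v\|+\|\mu^{\mathcal E}(\mathbf v)\|+|v|+1 .$$ A smooth function $s:[0,\infty)\to[0,\infty)$ is called *admissible* if $s'(r)>0$ for all $r\ge 0$ and the function $f(x)=s'\big(|\mu(x)|^2/2\big)$ satisfies $$\lim_{M\ni x\to\infty}\frac{f^2|v|^2}{|df|\,|v|+f\,\nu+1}=\infty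 .$$ Then the set of admissible functions is non-empty. Moreover, for every locally bounded function $\kappa:[0,\infty)\to[0,\infty)$ (that is, bounded on $[0,T]$ for every $T>0$) there is an admissible function $s$ such that $s(t)\ge\kappa(t)$ and $s'(t)\ge\kappa(t)$ for all $t>0$. -/

import Mathlib

open Bundle Manifold Filter Topology Set
open scoped ContDiff

namespace TamedKahler

noncomputable section

/-! ### A holomorphic manifold or bundle is also a smooth real manifold or bundle -/

section RealStructures

variable {EM : Type*} [NormedAddCommGroup EM] [NormedSpace ℂ EM]
  {M : Type*} [TopologicalSpace M] [ChartedSpace EM M]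

instance isManifold_real [IsManifold 𝓘(ℂ, EM) ω M] : IsManifold 𝓘(ℝ, EM) ∞ M := by
  refine isManifold_of_contDiffOn _ _ _ fun e e' he he' => ?_
  have h := ((contDiffGroupoid ω 𝓘(ℂ, EM)).compatible (M := M) he he')
  rw [contDiffGroupoid, mem_groupoid_of_pregroupoid] at h
  have h1 := h.1
  simp only [contDiffPregroupoid] at h1
  have h2 : ContDiffOn ℂ ω (𝓘(ℂ, EM) ∘ (e.symm ≫ₕ e') ∘ 𝓘(ℂ, EM).symm)
     (𝓘(ℂ, EM).symm ⁻¹' (e.symm ≫ₕ e').source ∩ range 𝓘(ℂ, EM)) := h1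
  exact (h2.restrict_scalars ℝ).of_le le_top

variable {FE : Type*} [NormedAddCommGroup FE] [NormedSpace ℂ FE]
  {E : M → Type*} [TopologicalSpace (TotalSpace FE E)]
  [∀ x, NormedAddCommGroup (E x)] [∀ x, InnerProductSpace ℂ (E x)]
  [FiberBundle FE E] 

instance vectorBundle_real [VectorBundle ℂ FE E] : VectorBundle ℝ FE E where
  trivialization_linear' e _ := by
    have := (trivialization_linear ℂ e).linear
    refine ⟨fun b hb => ⟨(this b hb).1, fun c x => ?_⟩⟩
    have h := (this b hb).2 (c : ℂ) x
    exact h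
  continuousOn_coordChange' e e' _ _ := by
    have hlin : ∀ (e : Trivialization FE (π FE E)) [MemTrivializationAtlas e], e.IsLinear ℝ := by
      intro e _
      have := (trivialization_linear ℂ e).linear
      exact ⟨fun b hb => ⟨(this b hb).1, fun c x => (this b hb).2 (c : ℂ) x⟩⟩
    have := hlin e
    have := hlin e'
    have h := continuousOn_coordChange ℂ e e' 
    refine ((ContinuousLinearMap.restrictScalarsL ℂ FE FE ℝ ℝ).continuous.comp_continuousOn h).congr
      fun b hb => ?_
    ext y
    change e.coordChangeL ℝ e' b y = e.coordChangeL ℂ e' b y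
    rw [e.coordChangeL_apply e' hb, e.coordChangeL_apply e' hb]

instance contMDiffVectorBundle_real [VectorBundle ℂ FE E] [ContMDiffVectorBundle ω FE E 𝓘(ℂ, EM)] :
    ContMDiffVectorBundle ∞ FE E 𝓘(ℝ, EM) where
  contMDiffOn_coordChangeL e e' _ _ := by
    have h := ContMDiffVectorBundle.contMDiffOn_coordChangeL (n := ω) (IB := 𝓘(ℂ, EM)) e e'
    have h' : ContMDiffOn 𝓘(ℝ, EM) 𝓘(ℝ, FE →L[ℂ] FE) ∞
        (fun b : M => (e.coordChangeL ℂ e' b : FE →L[ℂ] FE)) (e.baseSet ∩ e'.baseSet) :=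
      fun x hx => ⟨(h x hx).1, ((h x hx).2.restrict_scalars ℝ).of_le le_top⟩
    refine ((ContinuousLinearMap.restrictScalarsL ℂ FE FE ℝ ℝ).contMDiff.comp_contMDiffOn h').congr
      fun b hb => ?_
    ext y
    change e.coordChangeL ℝ e' b y = e.coordChangeL ℂ e' b y
    rw [e.coordChangeL_apply e' hb, e.coordChangeL_apply e' hb]
end RealStructures

/-! ### The Levi-Civita connection -/

section Riemannian

variable {E : Type*} [NormedAddCommGroup E] [NormedSpace ℝ E] [FiniteDimensional ℝ E]
  {M : Type*} [TopologicalSpace M] [ChartedSpace E M] [IsManifold 𝓘(ℝ, E) ∞ M]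

instance (x : M) : FiniteDimensional ℝ (TangentSpace 𝓘(ℝ, E) x) :=
  inferInstanceAs (FiniteDimensional ℝ E)

variable [RiemannianBundle (fun x : M => TangentSpace 𝓘(ℝ, E) x)]

instance (x : M) : CompleteSpace (TangentSpace 𝓘(ℝ, E) x) :=
  FiniteDimensional.complete ℝ _

/-- The Riemannian gradient. -/
def grad (f : M → ℝ) (x : M) : TangentSpace 𝓘(ℝ, E) x :=
  (InnerProductSpace.toDual ℝ (TangentSpace 𝓘(ℝ, E) x)).symm (mvfderiv 𝓘(ℝ, E) f x)

/-- The right-hand side of the Koszul formula for `2 ⟨∇_X Y, Z⟩`. -/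
def koszul (X Y Z : Π x : M, TangentSpace 𝓘(ℝ, E) x) (x : M) : ℝ :=
  mvfderiv 𝓘(ℝ, E) (fun y => inner ℝ (Y y) (Z y)) x (X x)
    + mvfderiv 𝓘(ℝ, E) (fun y => inner ℝ (X y) (Z y)) x (Y x)
    - mvfderiv 𝓘(ℝ, E) (fun y => inner ℝ (X y) (Y y)) x (Z x)
    + inner ℝ (VectorField.mlieBracket 𝓘(ℝ, E) X Y x) (Z x)
    - inner ℝ (VectorField.mlieBracket 𝓘(ℝ, E) X Z x) (Y x)
    - inner ℝ (VectorField.mlieBracket 𝓘(ℝ, E) Y Z x) (X x)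

variable [IsContMDiffRiemannianBundle 𝓘(ℝ, E) ∞ E (fun x : M => TangentSpace 𝓘(ℝ, E) x)]

set_option linter.unusedSectionVars false in
theorem mdifferentiableAt_inner {X Y : Π x : M, TangentSpace 𝓘(ℝ, E) x} {x : M}
    (hX : MDiffAt (T% X) x) (hY : MDiffAt (T% Y) x) :
    MDifferentiableAt 𝓘(ℝ, E) 𝓘(ℝ, ℝ) (fun y => (inner ℝ (X y) (Y y) : ℝ)) x :=
  MDifferentiableAt.inner_bundle (F := E) (E := fun x : M => TangentSpace 𝓘(ℝ, E) x)
    (b := fun y => y) hX hY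

theorem koszul_tensorial_left {Y Z : Π x : M, TangentSpace 𝓘(ℝ, E) x} {x : M}
    (hY : MDiffAt (T% Y) x) (hZ : MDiffAt (T% Z) x) :
    TensorialAt 𝓘(ℝ, E) E (koszul · Y Z x) x where
  smul {f X} hf hX := by
    have := FiniteDimensional.complete ℝ E
    have e1 : (fun y => inner ℝ ((f • X) y) (Z y)) = fun y => f y * inner ℝ (X y) (Z y) := by
      ext y; exact inner_smul_left (X y) (Z y) (f y)
    have e2 : (fun y => inner ℝ ((f • X) y) (Y y)) = fun y => f y * inner ℝ (X y) (Y y) := by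
      ext y; exact inner_smul_left (X y) (Y y) (f y)
    simp only [koszul]
    rw [VectorField.mlieBracket_smul_left hf hX, VectorField.mlieBracket_smul_left hf hX, e1, e2,
      mvfderiv_fun_mul hf (mdifferentiableAt_inner hX hZ),
      mvfderiv_fun_mul hf (mdifferentiableAt_inner hX hY)]
    simp [inner_smul_left, inner_smul_right, inner_add_left]
    ring
  add {X X'} hX hX' := by
    have := FiniteDimensional.complete ℝ E
    have e1 : (fun y => inner ℝ ((X + X') y) (Z y)) =
        fun y => inner ℝ (X y) (Z y) + inner ℝ (X' y) (Z y) := by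
      ext y; exact inner_add_left _ _ _
    have e2 : (fun y => inner ℝ ((X + X') y) (Y y)) =
        fun y => inner ℝ (X y) (Y y) + inner ℝ (X' y) (Y y) := by
      ext y; exact inner_add_left _ _ _
    simp only [koszul]
    rw [VectorField.mlieBracket_add_left hX hX', VectorField.mlieBracket_add_left hX hX', e1, e2,
      mvfderiv_fun_add (mdifferentiableAt_inner hX hZ) (mdifferentiableAt_inner hX' hZ),
      mvfderiv_fun_add (mdifferentiableAt_inner hX hY) (mdifferentiableAt_inner hX' hY)]
    simp [inner_add_left, inner_add_right]
    ring

theorem koszul_tensorial_right {X Y : Π x : M, TangentSpace 𝓘(ℝ, E) x} {x : M}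
    (hX : MDiffAt (T% X) x) (hY : MDiffAt (T% Y) x) :
    TensorialAt 𝓘(ℝ, E) E (koszul X Y · x) x where
  smul {f Z} hf hZ := by
    have := FiniteDimensional.complete ℝ E
    have e1 : (fun y => inner ℝ (Y y) ((f • Z) y)) = fun y => f y * inner ℝ (Y y) (Z y) := by
      ext y; exact inner_smul_right (Y y) (Z y) (f y)
    have e2 : (fun y => inner ℝ (X y) ((f • Z) y)) = fun y => f y * inner ℝ (X y) (Z y) := by
      ext y; exact inner_smul_right (X y) (Z y) (f y)
    simp only [koszul]
    rw [VectorField.mlieBracket_smul_right hf hZ, VectorField.mlieBracket_smul_right hf hZ, e1, e2,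
      mvfderiv_fun_mul hf (mdifferentiableAt_inner hX hZ),
      mvfderiv_fun_mul hf (mdifferentiableAt_inner hY hZ)]
    simp [inner_smul_left, inner_smul_right, inner_add_left, real_inner_comm (Z x)]
    ring
  add {Z Z'} hZ hZ' := by
    have := FiniteDimensional.complete ℝ E
    have e1 : (fun y => inner ℝ (Y y) ((Z + Z') y)) =
        fun y => inner ℝ (Y y) (Z y) + inner ℝ (Y y) (Z' y) := by
      ext y; exact inner_add_right _ _ _
    have e2 : (fun y => inner ℝ (X y) ((Z + Z') y)) =
        fun y => inner ℝ (X y) (Z y) + inner ℝ (X y) (Z' y) := by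
      ext y; exact inner_add_right _ _ _
    simp only [koszul]
    rw [VectorField.mlieBracket_add_right hZ hZ', VectorField.mlieBracket_add_right hZ hZ', e1, e2,
      mvfderiv_fun_add (mdifferentiableAt_inner hX hZ) (mdifferentiableAt_inner hX hZ'),
      mvfderiv_fun_add (mdifferentiableAt_inner hY hZ) (mdifferentiableAt_inner hY hZ')]
    simp [inner_add_left, inner_add_right]
    ring

open Classical in
/-- The Levi-Civita connection: `leviCivita Y x : u ↦ (∇_u Y)(x)`, given by the Koszul formula
(and by the junk value `0` where `Y` is not differentiable). -/
def leviCivita (Y : Π x : M, TangentSpace 𝓘(ℝ, E) x) (x : M) :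
    TangentSpace 𝓘(ℝ, E) x →L[ℝ] TangentSpace 𝓘(ℝ, E) x :=
  if hY : MDiffAt (T% Y) x then
    let B : TangentSpace 𝓘(ℝ, E) x →L[ℝ] TangentSpace 𝓘(ℝ, E) x →L[ℝ] ℝ :=
      TensorialAt.mkHom₂ (fun X Z => koszul X Y Z x) x
        (fun _ hZ => koszul_tensorial_left hY hZ) (fun _ hX => koszul_tensorial_right hX hY)
    LinearMap.toContinuousLinearMap
      { toFun := fun u =>
          (1 / 2 : ℝ) • (InnerProductSpace.toDual ℝ (TangentSpace 𝓘(ℝ, E) x)).symm (B u)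
        map_add' := fun u w => by simp
        map_smul' := fun c u => by simp [smul_comm c] }
  else 0

theorem inner_leviCivita {X Y Z : Π x : M, TangentSpace 𝓘(ℝ, E) x} {x : M}
    (hX : MDiffAt (T% X) x) (hY : MDiffAt (T% Y) x) (hZ : MDiffAt (T% Z) x) :
    inner ℝ (leviCivita Y x (X x)) (Z x) = koszul X Y Z x / 2 := by
  rw [leviCivita, dif_pos hY]
  simp only [LinearMap.coe_toContinuousLinearMap', LinearMap.coe_mk, AddHom.coe_mk]
  rw [real_inner_smul_left, InnerProductSpace.toDual_symm_apply,
    TensorialAt.mkHom₂_apply (fun _ hZ => koszul_tensorial_left hY hZ)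
      (fun _ hX => koszul_tensorial_right hX hY) hX hZ]
  ring

theorem leviCivita_torsion_free {X Y Z : Π x : M, TangentSpace 𝓘(ℝ, E) x} {x : M}
    (hX : MDiffAt (T% X) x) (hY : MDiffAt (T% Y) x) (hZ : MDiffAt (T% Z) x) :
    inner ℝ (leviCivita Y x (X x) - leviCivita X x (Y x) -
      VectorField.mlieBracket 𝓘(ℝ, E) X Y x) (Z x) = 0 := by
  rw [inner_sub_left, inner_sub_left, inner_leviCivita hX hY hZ, inner_leviCivita hY hX hZ]
  simp only [koszul]
  rw [VectorField.mlieBracket_swap (V := Y) (W := X)]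
  simp only [Pi.neg_apply, inner_neg_left]
  simp only [real_inner_comm]
  ring

theorem leviCivita_metric {X Y Z : Π x : M, TangentSpace 𝓘(ℝ, E) x} {x : M}
    (hX : MDiffAt (T% X) x) (hY : MDiffAt (T% Y) x) (hZ : MDiffAt (T% Z) x) :
    inner ℝ (leviCivita Y x (X x)) (Z x) + inner ℝ (Y x) (leviCivita Z x (X x)) =
      mvfderiv 𝓘(ℝ, E) (fun y => inner ℝ (Y y) (Z y)) x (X x) := by
  rw [real_inner_comm _ (Y x), inner_leviCivita hX hY hZ, inner_leviCivita hX hZ hY]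
  simp only [koszul]
  rw [VectorField.mlieBracket_swap (V := Y) (W := Z)]
  simp only [Pi.neg_apply, inner_neg_left]
  simp only [real_inner_comm]
  ring



end Riemannian

/-! ### Complex structure, Kähler metrics -/

section Kahler

variable {EM : Type*} [NormedAddCommGroup EM] [NormedSpace ℂ EM] [FiniteDimensional ℂ EM]
  {M : Type*} [TopologicalSpace M] [ChartedSpace EM M] [IsManifold 𝓘(ℂ, EM) ω M]

/-- The complex structure `J : TM → TM` of a complex manifold: multiplication by `i` in the
preferred holomorphic chart. -/
def J (x : M) : TangentSpace 𝓘(ℝ, EM) x →L[ℝ] TangentSpace 𝓘(ℝ, EM) x :=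
  ((Complex.I • ContinuousLinearMap.id ℂ EM).restrictScalars ℝ : EM →L[ℝ] EM)

variable [RiemannianBundle (fun x : M => TangentSpace 𝓘(ℝ, EM) x)]

variable (EM M) in
/-- The complex structure is anti-symmetric for the Riemannian metric: `J* = -J`. -/
def IsHermitianMetric : Prop :=
  ∀ (x : M) (u w : TangentSpace 𝓘(ℝ, EM) x), inner ℝ (J x u) w = -inner ℝ u (J x w)

/-- The fundamental 2-form `ω(u, w) = g(J u, w)`, so that `ω(u, J w) = g(u, w)`. -/
def kahlerForm (x : M) (u w : TangentSpace 𝓘(ℝ, EM) x) : ℝ := inner ℝ (J x u) w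

/-- The metric is Kähler on the set `U` (open in applications): the fundamental form is closed
there. The closedness `dω(X, Y, Z) = 0` is expressed by the invariant formula for the exterior
derivative. -/
def IsKahlerOn (U : Set M) : Prop :=
  ∀ X Y Z : Π x : M, TangentSpace 𝓘(ℝ, EM) x,
    ContMDiff 𝓘(ℝ, EM) 𝓘(ℝ, EM).tangent ∞ (fun x => (⟨x, X x⟩ : TangentBundle 𝓘(ℝ, EM) M)) →
    ContMDiff 𝓘(ℝ, EM) 𝓘(ℝ, EM).tangent ∞ (fun x => (⟨x, Y x⟩ : TangentBundle 𝓘(ℝ, EM) M)) →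
    ContMDiff 𝓘(ℝ, EM) 𝓘(ℝ, EM).tangent ∞ (fun x => (⟨x, Z x⟩ : TangentBundle 𝓘(ℝ, EM) M)) →
    ∀ x ∈ U,
      mvfderiv 𝓘(ℝ, EM) (fun y => kahlerForm y (Y y) (Z y)) x (X x)
        - mvfderiv 𝓘(ℝ, EM) (fun y => kahlerForm y (X y) (Z y)) x (Y x)
        + mvfderiv 𝓘(ℝ, EM) (fun y => kahlerForm y (X y) (Y y)) x (Z x)
        - kahlerForm x (VectorField.mlieBracket 𝓘(ℝ, EM) X Y x) (Z x)
        + kahlerForm x (VectorField.mlieBracket 𝓘(ℝ, EM) X Z x) (Y x)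
        - kahlerForm x (VectorField.mlieBracket 𝓘(ℝ, EM) Y Z x) (X x) = 0

end Kahler

/-! ### The Lie algebra, its dual, and invariant scalar products -/

section LieAlgebra

variable (EG : Type*) [NormedAddCommGroup EG] [NormedSpace ℝ EG]
  (G : Type*) [TopologicalSpace G] [ChartedSpace EG G] [Group G]

/-- The Lie algebra `𝔤 = T₁G`. The norm below only serves to fix its topology and its smooth
structure. -/
def LieAlg : Type _ := TangentSpace 𝓘(ℝ, EG) (1 : G)

instance : NormedAddCommGroup (LieAlg EG G) := inferInstanceAs (NormedAddCommGroup EG)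
instance : NormedSpace ℝ (LieAlg EG G) := inferInstanceAs (NormedSpace ℝ EG)
instance [FiniteDimensional ℝ EG] : FiniteDimensional ℝ (LieAlg EG G) :=
  inferInstanceAs (FiniteDimensional ℝ EG)

/-- The dual `𝔤*` of the Lie algebra. -/
abbrev LieCoalg : Type _ := LieAlg EG G →L[ℝ] ℝ

variable {G}

/-- The adjoint action `Ad g : 𝔤 → 𝔤`, the differential at `1` of `h ↦ g h g⁻¹`. -/
def Ad (g : G) : LieAlg EG G →L[ℝ] LieAlg EG G :=
  (mfderiv 𝓘(ℝ, EG) 𝓘(ℝ, EG) (fun h : G => g * h * g⁻¹) 1 : EG →L[ℝ] EG)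

/-- The coadjoint action of `G` on `𝔤*`. -/
def coAd (g : G) (ξ : LieCoalg EG G) : LieCoalg EG G := ξ ∘L Ad EG g⁻¹

variable (G)

/-- A `G`-invariant scalar product on `𝔤*`. -/
structure InvariantScalarProduct where
  form : LieCoalg EG G →ₗ[ℝ] LieCoalg EG G →ₗ[ℝ] ℝ
  symm : ∀ ξ η, form ξ η = form η ξ
  pos : ∀ ξ, ξ ≠ 0 → 0 < form ξ ξ
  invariant : ∀ (g : G) ξ η, form (coAd EG g ξ) (coAd EG g η) = form ξ η

variable {EG G}

/-- The isomorphism `ψ : 𝔤* → 𝔤` given by the scalar product: `ξ (ψ η) = ⟨ξ, η⟩`. -/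
def InvariantScalarProduct.psi [FiniteDimensional ℝ EG] (B : InvariantScalarProduct EG G)
    (η : LieCoalg EG G) : LieAlg EG G :=
  (Module.evalEquiv ℝ (LieAlg EG G)).symm
    (B.form.flip η ∘ₗ (LinearMap.toContinuousLinearMap :
      (LieAlg EG G →ₗ[ℝ] ℝ) ≃ₗ[ℝ] (LieAlg EG G →L[ℝ] ℝ)).toLinearMap)

theorem InvariantScalarProduct.apply_psi [FiniteDimensional ℝ EG]
    (B : InvariantScalarProduct EG G) (ξ η : LieCoalg EG G) : ξ (B.psi η) = B.form ξ η := by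
  have h := Module.apply_evalEquiv_symm_apply ℝ (LieAlg EG G) (ξ : LieAlg EG G →ₗ[ℝ] ℝ)
    (B.form.flip η ∘ₗ (LinearMap.toContinuousLinearMap :
      (LieAlg EG G →ₗ[ℝ] ℝ) ≃ₗ[ℝ] (LieAlg EG G →L[ℝ] ℝ)).toLinearMap)
  exact h

end LieAlgebra

/-! ### Tamed asymptotically Kähler manifolds -/

section Tamed

variable {EM : Type*} [NormedAddCommGroup EM] [NormedSpace ℂ EM] [FiniteDimensional ℂ EM]
  {M : Type*} [TopologicalSpace M] [ChartedSpace EM M] [IsManifold 𝓘(ℂ, EM) ω M]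
  {EG : Type*} [NormedAddCommGroup EG] [NormedSpace ℝ EG] [FiniteDimensional ℝ EG]
  {G : Type*} [TopologicalSpace G] [ChartedSpace EG G] [Group G] [MulAction G M]

/-- The vector field `u_M` on `M` generated by `u ∈ 𝔤`: the image of `u` under the differential at
`1` of the orbit map `g ↦ g • x`, i.e. `d/dt exp(t u) • x` at `t = 0`. -/
def fundamentalField (u : LieAlg EG G) (x : M) : TangentSpace 𝓘(ℝ, EM) x :=
  (mfderiv 𝓘(ℝ, EG) 𝓘(ℝ, EM) (fun g : G => g • x) 1 : EG →L[ℝ] EM) u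

/-- The function `|μ|²/2`. -/
def halfNormSq (B : InvariantScalarProduct EG G) (μ : M → LieCoalg EG G) (x : M) : ℝ :=
  B.form (μ x) (μ x) / 2

variable [RiemannianBundle (fun x : M => TangentSpace 𝓘(ℝ, EM) x)]

/-- The vector field `v = -J ∇(|μ|²/2)`. -/
def tamingField (B : InvariantScalarProduct EG G) (μ : M → LieCoalg EG G) (x : M) :
    TangentSpace 𝓘(ℝ, EM) x :=
  -J x (grad (halfNormSq B μ) x)

/-- `μ` is a moment map on the (`G`-invariant, open) set `U`: it is smooth and `G`-equivariant
there, and `d⟨μ, u⟩ = ι(u_M) ω` for every `u ∈ 𝔤`. -/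
structure IsMomentMapOn (U : Set M) (μ : M → LieCoalg EG G) : Prop where
  smooth : ContMDiffOn 𝓘(ℝ, EM) 𝓘(ℝ, LieCoalg EG G) ∞ μ U
  equivariant : ∀ (g : G), ∀ x ∈ U, μ (g • x) = coAd EG g (μ x)
  deriv_eq : ∀ (u : LieAlg EG G), ∀ x ∈ U, ∀ w : TangentSpace 𝓘(ℝ, EM) x,
    mvfderiv 𝓘(ℝ, EM) (fun y => μ y u) x w = kahlerForm x (fundamentalField u x) w

/-- The conditions making a complete complex manifold with a Hermitian Riemannian metric and a
holomorphic `G`-action into a tamed asymptotically Kähler manifold with moment map `μ`.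

Outside a `G`-invariant compact set `K` the metric is Kähler, `G` acts by isometries and `μ` is a
moment map. `μ` is given on all of `M` but nothing is required of its values on `K`, so `μ` may be
any extension to `M` of a moment map defined on `M \ K`. Properness says that `μ x → ∞` as
`x → ∞` in `M`. -/
structure IsTamed (B : InvariantScalarProduct EG G) (μ : M → LieCoalg EG G) : Prop where
  hermitian : IsHermitianMetric EM M
  holomorphic_action : ∀ g : G, ContMDiff 𝓘(ℂ, EM) 𝓘(ℂ, EM) ω (fun x : M => g • x)
  asymptotically_hamiltonian : ∃ K : Set M, IsCompact K ∧ (∀ (g : G), ∀ x ∈ K, g • x ∈ K) ∧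
    IsKahlerOn (EM := EM) Kᶜ ∧
    (∀ (g : G), ∀ x ∈ Kᶜ, ∀ w w' : TangentSpace 𝓘(ℝ, EM) x,
      inner ℝ (mfderiv 𝓘(ℝ, EM) 𝓘(ℝ, EM) (fun y : M => g • y) x w)
        (mfderiv 𝓘(ℝ, EM) 𝓘(ℝ, EM) (fun y : M => g • y) x w') = inner ℝ w w') ∧
    IsMomentMapOn (EM := EM) Kᶜ μ
  proper : Tendsto μ (cocompact M) (cocompact (LieCoalg EG G))
  nonvanishing : ∃ K : Set M, IsCompact K ∧ ∀ x ∉ K, tamingField (EM := EM) B μ x ≠ 0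

end Tamed

/-! ### Equivariant holomorphic Hermitian bundles -/

section EquivariantBundle

variable {EM : Type*} [NormedAddCommGroup EM] [NormedSpace ℂ EM] [FiniteDimensional ℂ EM]
  {M : Type*} [TopologicalSpace M] [ChartedSpace EM M] [IsManifold 𝓘(ℂ, EM) ω M]
  {EG : Type*} [NormedAddCommGroup EG] [NormedSpace ℝ EG]
  {G : Type*} [TopologicalSpace G] [ChartedSpace EG G] [Group G] [MulAction G M]
  {FE : Type*} [NormedAddCommGroup FE] [NormedSpace ℂ FE]
  {E : M → Type*} [TopologicalSpace (TotalSpace FE E)]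
  [∀ x, NormedAddCommGroup (E x)] [∀ x, InnerProductSpace ℂ (E x)]
  [FiberBundle FE E]

variable (EM FE E) in
/-- The Hermitian metric on the fibres of `E` is smooth: it has smooth values on (local) smooth
sections. -/
def IsSmoothHermitianBundle : Prop :=
  ∀ (U : Set M) (σ τ : Π x : M, E x), IsOpen U →
    ContMDiffOn 𝓘(ℝ, EM) (𝓘(ℝ, EM).prod 𝓘(ℝ, FE)) ∞ (fun x => (⟨x, σ x⟩ : TotalSpace FE E)) U →
    ContMDiffOn 𝓘(ℝ, EM) (𝓘(ℝ, EM).prod 𝓘(ℝ, FE)) ∞ (fun x => (⟨x, τ x⟩ : TotalSpace FE E)) U →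
    ContMDiffOn 𝓘(ℝ, EM) 𝓘(ℝ, ℂ) ∞ (fun x => (inner ℂ (σ x) (τ x) : ℂ)) U

variable (EM EG G FE E) in
/-- A lift of the action of `G` on `M` to the holomorphic vector bundle `E`: `G` acts on the total
space by maps which are linear on fibres, smoothly in `(g, e)`, and holomorphically for each
`g`. -/
structure EquivariantStructure where
  map : ∀ (g : G) (x : M), E x →L[ℂ] E (g • x)
  map_one : ∀ (x : M) (e : E x),
    (⟨(1 : G) • x, map 1 x e⟩ : TotalSpace FE E) = ⟨x, e⟩
  map_mul : ∀ (g h : G) (x : M) (e : E x),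
    (⟨(g * h) • x, map (g * h) x e⟩ : TotalSpace FE E) = ⟨g • h • x, map g (h • x) (map h x e)⟩
  smooth : ContMDiff (𝓘(ℝ, EG).prod (𝓘(ℝ, EM).prod 𝓘(ℝ, FE))) (𝓘(ℝ, EM).prod 𝓘(ℝ, FE)) ∞
    (fun p : G × TotalSpace FE E => (⟨p.1 • p.2.1, map p.1 p.2.1 p.2.2⟩ : TotalSpace FE E))
  holomorphic : ∀ g : G,
    ContMDiff (𝓘(ℂ, EM).prod 𝓘(ℂ, FE)) (𝓘(ℂ, EM).prod 𝓘(ℂ, FE)) ω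
      (fun p : TotalSpace FE E => (⟨g • p.1, map g p.1 p.2⟩ : TotalSpace FE E))

/-- The map `E_{g x} → E_x` given by the action of `g⁻¹`. -/
def EquivariantStructure.pullback (A : EquivariantStructure EM EG G FE E) (g : G) (x : M)
    (e : E (g • x)) : E x :=
  (inv_smul_smul g x) ▸ A.map g⁻¹ (g • x) e

/-- The infinitesimal action `L_u` of `u ∈ 𝔤` on sections of `E`:
`(L_u σ)(x) = d/dt exp(-t u) σ(exp(t u) x)` at `t = 0`, i.e. the differential at `1` of
`g ↦ g⁻¹ σ(g x) ∈ E_x`, applied to `u`. -/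
def EquivariantStructure.lieDeriv (A : EquivariantStructure EM EG G FE E) (u : LieAlg EG G)
    (σ : Π x : M, E x) (x : M) : E x :=
  (mvfderiv 𝓘(ℝ, EG) (fun g : G => A.pullback g x (σ (g • x))) 1 : EG →L[ℝ] E x) u

/-- A smooth `G`-invariant connection on the complex vector bundle `E`, compatible with its
holomorphic structure: `∇^{0,1} = ∂̄`, i.e. `∇σ` is complex linear in the direction if `σ` is a
local holomorphic section. -/
structure IsInvariantHolomorphicConnection [VectorBundle ℂ FE E]
    (A : EquivariantStructure EM EG G FE E) (nabla : CovariantDerivative 𝓘(ℝ, EM) FE E) :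
    Prop where
  smooth : CovariantDerivative.ContMDiffCovariantDerivative nabla ∞
  complex_linear : ∀ (σ : Π x : M, E x) (x : M),
    MDifferentiableAt 𝓘(ℝ, EM) (𝓘(ℝ, EM).prod 𝓘(ℝ, FE))
      (fun y => (⟨y, σ y⟩ : TotalSpace FE E)) x →
    ∀ w : TangentSpace 𝓘(ℝ, EM) x,
      nabla (fun y => Complex.I • σ y) x w = Complex.I • nabla σ x w
  holomorphic : ∀ (σ : Π x : M, E x) (x : M),
    ContMDiffAt 𝓘(ℂ, EM) (𝓘(ℂ, EM).prod 𝓘(ℂ, FE)) ω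
      (fun y => (⟨y, σ y⟩ : TotalSpace FE E)) x →
    ∀ w : TangentSpace 𝓘(ℝ, EM) x, nabla σ x (J x w) = Complex.I • nabla σ x w
  invariant : ∀ (g : G) (σ τ : Π x : M, E x), (∀ y, τ (g • y) = A.map g y (σ y)) → ∀ x : M,
    MDifferentiableAt 𝓘(ℝ, EM) (𝓘(ℝ, EM).prod 𝓘(ℝ, FE))
      (fun y => (⟨y, σ y⟩ : TotalSpace FE E)) x →
    ∀ w : TangentSpace 𝓘(ℝ, EM) x,
      nabla τ (g • x) (mfderiv 𝓘(ℝ, EM) 𝓘(ℝ, EM) (fun y : M => g • y) x w)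
        = A.map g x (nabla σ x w)

end EquivariantBundle

/-! ### The moment of the connection on `𝓔 = E ⊗ Λ^•(T^{0,1}M)^*`, and admissible functions -/

section Admissible

variable {EM : Type*} [NormedAddCommGroup EM] [NormedSpace ℂ EM] [FiniteDimensional ℂ EM]
  {M : Type*} [TopologicalSpace M] [ChartedSpace EM M] [IsManifold 𝓘(ℂ, EM) ω M]
  [RiemannianBundle (fun x : M => TangentSpace 𝓘(ℝ, EM) x)]
  [IsContMDiffRiemannianBundle 𝓘(ℝ, EM) ∞ EM (fun x : M => TangentSpace 𝓘(ℝ, EM) x)]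
  {EG : Type*} [NormedAddCommGroup EG] [NormedSpace ℝ EG] [FiniteDimensional ℝ EG]
  {G : Type*} [TopologicalSpace G] [ChartedSpace EG G] [Group G] [MulAction G M]
  {FE : Type*} [NormedAddCommGroup FE] [NormedSpace ℂ FE]
  {E : M → Type*} [TopologicalSpace (TotalSpace FE E)]
  [∀ x, NormedAddCommGroup (E x)] [∀ x, InnerProductSpace ℂ (E x)]
  [FiberBundle FE E]

variable (E) in
/-- The fibre at `x` of `E ⊗ Λ^p(T^{0,1}M)^*`: the `E_x`-valued alternating real `p`-forms on
`T_xM` which are conjugate-linear in every argument. -/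
def antiholomorphicForms (x : M) (p : ℕ) :
    Submodule ℂ (TangentSpace 𝓘(ℝ, EM) x [⋀^Fin p]→ₗ[ℝ] E x) where
  carrier := {α | ∀ (w : Fin p → TangentSpace 𝓘(ℝ, EM) x) (j : Fin p),
    α (Function.update w j (J x (w j))) = -(Complex.I • α w)}
  add_mem' {α β} hα hβ w j := by
    simp only [AlternatingMap.add_apply, hα w j, hβ w j, smul_add, neg_add]
  zero_mem' w j := by simp
  smul_mem' c α hα w j := by
    simp only [AlternatingMap.smul_apply, hα w j, smul_neg, smul_comm c Complex.I]

variable (EM E) in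
/-- The fibre at `x` of `𝓔 = E ⊗ Λ^•(T^{0,1}M)^*`. -/
abbrev SpinorFiber (x : M) : Type _ :=
  Π p : Fin (Module.finrank ℂ EM + 1), antiholomorphicForms (EM := EM) E x p

/-- The norm on `E ⊗ Λ^•(T_x^*M ⊗ ℂ)` induced by the metrics of `E` and `M`:
`|α|² = ∑_p (1/p!) ∑_{i₁, …, i_p} |α_p(e_{i₁}, …, e_{i_p})|²` for an orthonormal basis `(e_i)` of
`T_xM`. -/
def formNorm (x : M)
    (α : Π p : Fin (Module.finrank ℂ EM + 1), (Fin p → TangentSpace 𝓘(ℝ, EM) x) → E x) : ℝ :=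
  √(∑ p : Fin (Module.finrank ℂ EM + 1),
    (∑ i : Fin p → Fin (Module.finrank ℝ (TangentSpace 𝓘(ℝ, EM) x)),
      ‖α p (fun k => stdOrthonormalBasis ℝ (TangentSpace 𝓘(ℝ, EM) x) (i k))‖ ^ 2)
        / (Nat.factorial p : ℝ))

/-- The endomorphism `∇_{u_M} - L_u` of `E_x`; it is computed on a local smooth section through
the given vector. -/
def bundleMoment (A : EquivariantStructure EM EG G FE E)
    (nabla : CovariantDerivative 𝓘(ℝ, EM) FE E) (u : LieAlg EG G) (x : M) (e : E x) : E x :=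
  nabla (FiberBundle.extend FE e) x (fundamentalField u x)
    - A.lieDeriv u (FiberBundle.extend FE e) x

/-- The endomorphism `∇^{LC}_{u_M} - L_u` of `T_xM`, where `L_u Y = [u_M, Y]` is the infinitesimal
action of `u` on vector fields; it is computed on a local smooth vector field through the given
vector. -/
def tangentMoment (u : LieAlg EG G) (x : M) (w : TangentSpace 𝓘(ℝ, EM) x) :
    TangentSpace 𝓘(ℝ, EM) x :=
  leviCivita (FiberBundle.extend EM (E := fun x : M => TangentSpace 𝓘(ℝ, EM) x) w) x
      (fundamentalField u x)
    - VectorField.mlieBracket 𝓘(ℝ, EM) (fundamentalField u)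
      (FiberBundle.extend EM (E := fun x : M => TangentSpace 𝓘(ℝ, EM) x) w) x

/-- The endomorphism `μ^𝓔(u) = ∇^𝓔_{u_M} - L^𝓔_u` of `𝓔_x`. Both `∇^𝓔` (the tensor product of
`∇` on `E` and the Levi-Civita connection) and `L^𝓔_u` (induced by the actions on `E` and on
`M`) obey the Leibniz rule
`(D α)(Y₁, …, Y_p) = D (α(Y₁, …, Y_p)) - ∑_j α(Y₁, …, D Y_j, …, Y_p)`, hence so does their
difference. (Where the metric is Kähler and preserved by the action, the result is again in
`𝓔_x`.) -/
def spinorMoment (A : EquivariantStructure EM EG G FE E)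
    (nabla : CovariantDerivative 𝓘(ℝ, EM) FE E) (u : LieAlg EG G) (x : M)
    (α : SpinorFiber EM E x) (p : Fin (Module.finrank ℂ EM + 1))
    (w : Fin p → TangentSpace 𝓘(ℝ, EM) x) : E x :=
  bundleMoment A nabla u x ((α p).1 w)
    - ∑ j, (α p).1 (Function.update w j (tangentMoment u x (w j)))

/-- The operator norm `‖μ^𝓔(u)‖` at the point `x`. -/
def spinorMomentNorm (A : EquivariantStructure EM EG G FE E)
    (nabla : CovariantDerivative 𝓘(ℝ, EM) FE E) (u : LieAlg EG G) (x : M) : ℝ :=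
  sInf {C : ℝ | 0 ≤ C ∧ ∀ α : SpinorFiber EM E x,
    formNorm x (spinorMoment A nabla u x α) ≤ C * formNorm x (fun p w => (α p).1 w)}

/-- `ν = |𝐯| + ‖∇^{LC} v‖ + ‖μ^𝓔(𝐯)‖ + |v| + 1`, where `𝐯 = ψ(μ)`; since the norm on `𝔤` is the one
for which `ψ` is an isometry, `|𝐯| = |μ|`. -/
def nu (B : InvariantScalarProduct EG G) (μ : M → LieCoalg EG G)
    (A : EquivariantStructure EM EG G FE E) (nabla : CovariantDerivative 𝓘(ℝ, EM) FE E)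
    (x : M) : ℝ :=
  √(B.form (μ x) (μ x)) + ‖leviCivita (E := EM) (tamingField B μ) x‖
    + spinorMomentNorm A nabla (B.psi (μ x)) x + ‖tamingField (EM := EM) B μ x‖ + 1

/-- Admissible functions `s : [0, ∞) → [0, ∞)`, represented by functions `ℝ → ℝ` whose values on
negative numbers are irrelevant: `s` is smooth, `s' > 0`, and `f = s'(|μ|²/2)` satisfies
`f² |v|² / (|df| |v| + f ν + 1) → ∞` at infinity of `M`. -/
def admissible (B : InvariantScalarProduct EG G) (μ : M → LieCoalg EG G)
    (A : EquivariantStructure EM EG G FE E) (nabla : CovariantDerivative 𝓘(ℝ, EM) FE E) :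
    Set (ℝ → ℝ) :=
  {s | ContDiffOn ℝ ∞ s (Ici 0) ∧ MapsTo s (Ici 0) (Ici 0) ∧
    (∀ r ∈ Ici (0 : ℝ), 0 < derivWithin s (Ici 0) r) ∧
    let f : M → ℝ := fun x => derivWithin s (Ici 0) (halfNormSq B μ x)
    let v : Π x : M, TangentSpace 𝓘(ℝ, EM) x := tamingField B μ
    Tendsto (fun x => f x ^ 2 * ‖v x‖ ^ 2 /
      (‖mvfderiv 𝓘(ℝ, EM) f x‖ * ‖v x‖ + f x * nu B μ A nabla x + 1)) (cocompact M) atTop}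

end Admissible

end

end TamedKahler

namespace TamedKahler

noncomputable section

set_option linter.unusedSectionVars false

/-! ### Smooth functions of rapid growth with slowly varying reciprocal -/

/-! Write φ = |μ|²/2, h = s' and f = h(φ). Since `J` is an isometry, |dφ| = |v|, so |df||v| =
|h'(φ)||v|² outside a compact set. When h ≥ 1, the reciprocal of the quotient in the definition of
admissibility is therefore at most |h'(φ)|/h(φ)² + (ν+1)/(h(φ)|v|²). It suffices that h'/h² → 0 and
that h(φ) dominates (⌊φ⌋+1)(ν+1)/|v|² near infinity (`tendsto_growth_quotient`).

The first condition says that 1/h has derivative tending to 0. This is compatible with arbitrarily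
fast growth of h: take 1/h to be the tail integral of a positive smooth function lying below e^{-t}
divided by the prescribed growth (`exists_contDiff_growth`).

For the second condition, φ is proper because μ is proper and the scalar product is positive
definite. Hence (ν+1)/|v|² is bounded by a function of ⌊φ⌋ as soon as it is locally bounded outside
a compact set (`exists_le_of_locally_bounded`). There |v| is continuous and nonzero, and every
summand of ν is locally bounded (`IsMomentMapOn.exists_nu_div_le`). The moment map equation gives
v(x) = u_M(x) with u = ψ(μ(x)), so v is smooth and the Koszul formula bounds ∇v. The moments ∇_{u_M}
- L_u on TM and on E are tensorial and linear in u, so they can be estimated in local frames. Only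
local upper bounds are needed, never continuity of the operator norms.

Finally s is a constant plus the primitive of h. Letting h also dominate κ, with a margin for a unit
shift of the argument, gives the bounds on s' and s. -/

theorem exists_contDiff_pos_lt_exp_neg_div {b : ℕ → ℝ} (hb : Monotone b) (hb0 : ∀ n, 0 < b n) :
    ∃ q : ℝ → ℝ, ContDiff ℝ ∞ q ∧ ∀ t, 0 < q t ∧ q t < Real.exp (-t) / b ⌊t⌋₊ := by
  obtain ⟨g, hg⟩ := exists_contMDiffMap_forall_mem_convex_of_local_const (n := ⊤) 𝓘(ℝ, ℝ)
    (t := fun t : ℝ => Ioo 0 (Real.exp (-t) / b ⌊t⌋₊)) (fun t => convex_Ioo _ _) (fun t => by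
      have hpos : 0 < Real.exp (-(t + 1)) / b (⌊t⌋₊ + 1) := div_pos (Real.exp_pos _) (hb0 _)
      -- The upper bound is decreasing but jumps at integers. A constant taken one unit further
      -- right lies below it for all y < t + 1; halving makes the inequality strict.
      refine ⟨Real.exp (-(t + 1)) / b (⌊t⌋₊ + 1) / 2, ?_⟩
      filter_upwards [Iio_mem_nhds (lt_add_one t)] with y (hy : y < t + 1)
      refine ⟨half_pos hpos, (half_lt_self hpos).trans_le ?_⟩
      refine div_le_div₀ (Real.exp_pos _).le (Real.exp_le_exp.2 (by linarith)) (hb0 _) (hb ?_)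
      rcases le_or_gt 0 t with ht | ht
      · rw [← Nat.floor_add_one ht]
        exact Nat.floor_mono hy.le
      · exact (Nat.floor_mono hy.le).trans (by rw [Nat.floor_of_nonpos ht.le]
                                               exact Nat.floor_le_of_le (by simp; linarith)))
  exact ⟨g, g.contMDiff.contDiff, fun t => hg t⟩

/-- Take p(t) = ∫_t^∞ q with q < e^{-t}/b(⌊t⌋). Then p' = -q tends to 0, and monotonicity of b lets
1/b(⌊t⌋) be pulled out of the tail integral of e^{-s}. -/
theorem exists_contDiff_pos_le_inv {b : ℕ → ℝ} (hb : Monotone b) (hb0 : ∀ n, 1 ≤ b n) :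
    ∃ p : ℝ → ℝ, ContDiff ℝ ∞ p ∧ (∀ t, 0 < p t) ∧ (∀ t, 0 ≤ t → p t ≤ (b ⌊t⌋₊)⁻¹) ∧
      Tendsto (deriv p) atTop (𝓝 0) := by
  have hb1 : ∀ n, 0 < b n := fun n => zero_lt_one.trans_le (hb0 n)
  obtain ⟨q, hq, hq'⟩ := exists_contDiff_pos_lt_exp_neg_div hb hb1
  have hqexp : ∀ t, q t ≤ Real.exp (-t) := fun t =>
    (hq' t).2.le.trans (div_le_self (Real.exp_pos _).le (hb0 _))
  have hint : ∀ t, MeasureTheory.IntegrableOn q (Ioi t) := fun t =>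
    (integrableOn_exp_neg_Ioi t).mono' hq.continuous.aestronglyMeasurable
      (MeasureTheory.ae_of_all _ fun s => by rw [Real.norm_of_nonneg (hq' s).1.le]; exact hqexp s)
  have heq : (fun t => ∫ s in Ioi t, q s) = fun t => (∫ s in Ioi 0, q s) - ∫ s in (0)..t, q s := by
    ext t
    rw [← intervalIntegral.integral_Ioi_sub_Ioi' (hint 0) (hint t)]
    ring
  have hder : ∀ t, HasDerivAt (fun t => ∫ s in Ioi t, q s) (-q t) t := fun t => by
    rw [heq]
    exact (intervalIntegral.integral_hasDerivAt_right (hq.continuous.intervalIntegrable _ _)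
      hq.continuous.stronglyMeasurable.stronglyMeasurableAtFilter
      hq.continuous.continuousAt).const_sub _
  have hderiv : deriv (fun t => ∫ s in Ioi t, q s) = fun t => -q t := funext fun t => (hder t).deriv
  refine ⟨fun t => ∫ s in Ioi t, q s, ?_, fun t => ?_, fun t ht => ?_, ?_⟩
  · refine contDiff_infty_iff_deriv.2 ⟨fun t => (hder t).differentiableAt, ?_⟩
    rw [hderiv]
    exact hq.neg
  · rw [MeasureTheory.setIntegral_pos_iff_support_of_nonneg_ae
      (MeasureTheory.ae_of_all _ fun s => (hq' s).1.le) (hint t)]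
    have : Function.support q = univ := eq_univ_of_forall fun s => (hq' s).1.ne'
    simp [this]
  · calc ∫ s in Ioi t, q s ≤ ∫ s in Ioi t, Real.exp (-s) * (b ⌊t⌋₊)⁻¹ := by
          refine MeasureTheory.setIntegral_mono_on (hint t)
            ((integrableOn_exp_neg_Ioi t).mul_const _) measurableSet_Ioi fun s (hs : t < s) => ?_
          refine (hq' s).2.le.trans ?_
          rw [div_eq_mul_inv]
          gcongr
          · exact hb1 _
          · exact hb (Nat.floor_mono hs.le)
      _ = Real.exp (-t) * (b ⌊t⌋₊)⁻¹ := by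
          rw [MeasureTheory.integral_mul_const, integral_exp_neg_Ioi]
      _ ≤ (b ⌊t⌋₊)⁻¹ :=
          mul_le_of_le_one_left (inv_nonneg.2 (hb1 _).le) (Real.exp_le_one_iff.2 (by linarith))
  · rw [hderiv, ← neg_zero]
    refine Tendsto.neg (squeeze_zero (fun t => (hq' t).1.le) hqexp ?_)
    exact Real.tendsto_exp_neg_atTop_nhds_zero

/-- There are positive smooth functions growing faster than any given sequence, with reciprocals
whose derivatives tend to zero. -/
theorem exists_contDiff_growth (b : ℕ → ℝ) :
    ∃ h : ℝ → ℝ, ContDiff ℝ ∞ h ∧ (∀ t, 0 < h t) ∧ (∀ t, 0 ≤ t → ∀ k ≤ ⌊t⌋₊, b k ≤ h t) ∧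
      Tendsto (fun t => deriv h t / h t ^ 2) atTop (𝓝 0) := by
  -- A monotone sequence, at least 1, that dominates all earlier terms of `b`.
  have hmono : Monotone fun n => 1 + ∑ k ∈ Finset.range (n + 1), |b k| := fun m n hmn => by
    dsimp only
    gcongr
  obtain ⟨p, hp, hp0, hpb, hpd⟩ := exists_contDiff_pos_le_inv hmono fun n =>
    le_add_of_nonneg_right (Finset.sum_nonneg fun k _ => abs_nonneg (b k))
  refine ⟨fun t => (p t)⁻¹, hp.inv fun t => (hp0 t).ne', fun t => inv_pos.2 (hp0 t),
    fun t ht k hk => ?_, ?_⟩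
  · have h1 : b k ≤ 1 + ∑ k ∈ Finset.range (⌊t⌋₊ + 1), |b k| :=
      (le_abs_self _).trans ((Finset.single_le_sum (f := fun k => |b k|)
        (fun k _ => abs_nonneg (b k)) (Finset.mem_range.2 (by omega))).trans
        (le_add_of_nonneg_left zero_le_one))
    refine h1.trans ?_
    have h2 := hpb t ht
    exact (le_inv_comm₀ (hp0 t) (by positivity)).1 h2
  -- For h = 1/p one has h'/h² = -p'.
  · refine (neg_zero (G := ℝ) ▸ hpd.neg).congr fun t => ?_
    have hd : DifferentiableAt ℝ p t := (hp.differentiable (by simp)) t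
    rw [show deriv (fun t => (p t)⁻¹) t = -deriv p t / p t ^ 2 from
      (hd.hasDerivAt.inv (hp0 t).ne').deriv]
    have := (hp0 t).ne'
    field_simp

/-! ### Comparison with functions of an exhausting function -/

/-- A function which is locally bounded above outside a compact set is bounded by a function of the
integral part of an exhausting function. -/
theorem exists_le_of_locally_bounded {X : Type*} [TopologicalSpace X] [T2Space X]
    [WeaklyLocallyCompactSpace X] {φ q : X → ℝ} (hφ : Tendsto φ (cocompact X) atTop) {K : Set X}
    (hK : IsCompact K) (hq : ∀ x ∉ K, ∃ C : ℝ, ∀ᶠ y in 𝓝 x, q y ≤ C) :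
    ∃ b : ℕ → ℝ, ∀ᶠ x in cocompact X, q x ≤ b ⌊φ x⌋₊ := by
  obtain ⟨L, hL, hKL⟩ := exists_compact_superset hK
  have hbdd : ∀ n : ℕ, ∃ C : ℝ, ∀ x, x ∉ L → φ x < n + 1 → q x ≤ C := fun n => by
    -- Properness puts {φ < n + 1} inside a compact `Q`. Removing the interior of `L`, which
    -- contains `K`, keeps it compact and away from the points where `q` is not controlled.
    obtain ⟨Q, hQ, hφQ⟩ := mem_cocompact.1 (hφ (Ici_mem_atTop (n + 1 : ℝ)))
    have hc : IsCompact (Q \ interior L) := hQ.diff isOpen_interior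
    have hb : BddAbove (q '' (Q \ interior L)) := by
      refine hc.induction_on (p := fun s => BddAbove (q '' s)) (by simp)
        (fun s t hst ht => ht.mono (image_mono hst))
        (fun s t hs ht => by rw [image_union]; exact hs.union ht) fun x hx => ?_
      obtain ⟨C, hC⟩ := hq x fun h => hx.2 (hKL h)
      exact ⟨_, mem_nhdsWithin_of_mem_nhds hC, C, by rintro _ ⟨y, hy, rfl⟩; exact hy⟩
    obtain ⟨C, hC⟩ := hb
    refine ⟨C, fun x hxL hx => hC ⟨x, ⟨by_contra fun hxQ => ?_, fun h => hxL (interior_subset h)⟩, rfl⟩⟩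
    exact absurd (show (n + 1 : ℝ) ≤ φ x from hφQ hxQ) hx.not_ge
  choose b hb using hbdd
  refine ⟨b, ?_⟩
  filter_upwards [hL.compl_mem_cocompact] with x hx
  exact hb _ x hx (Nat.lt_floor_add_one _)

/-- The reciprocal is positive and splits into DV/(h²V²) ≤ |h'|/h² and (hν+1)/(h²V²) ≤ (ν+1)/(hV²) ≤
1/(⌊φ⌋+1), where h ≥ 1 is used. Both bounds tend to 0. -/
theorem tendsto_growth_quotient {ι : Type*} {l : Filter ι} {φ V ν D : ι → ℝ} {h : ℝ → ℝ}
    (hφ : Tendsto φ l atTop) (hV : ∀ᶠ x in l, 0 < V x) (hν : ∀ᶠ x in l, 0 ≤ ν x)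
    (hD0 : ∀ x, 0 ≤ D x) (hD : ∀ᶠ x in l, D x ≤ |deriv h (φ x)| * V x) (hh : ∀ t, 0 < h t)
    (hh1 : ∀ᶠ x in l, 1 ≤ h (φ x))
    (hq : ∀ᶠ x in l, (⌊φ x⌋₊ + 1 : ℝ) * ((ν x + 1) / V x ^ 2) ≤ h (φ x))
    (hhd : Tendsto (fun t => deriv h t / h t ^ 2) atTop (𝓝 0)) :
    Tendsto (fun x => h (φ x) ^ 2 * V x ^ 2 / (D x * V x + h (φ x) * ν x + 1)) l atTop := by
  have hfloor : Tendsto (fun x => (⌊φ x⌋₊ + 1 : ℝ)⁻¹) l (𝓝 0) :=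
    tendsto_inv_atTop_zero.comp (tendsto_atTop_add_const_right _ _
      (tendsto_natCast_atTop_atTop.comp (tendsto_nat_floor_atTop.comp hφ)))
  have hsum : Tendsto (fun x => |deriv h (φ x) / h (φ x) ^ 2| + (⌊φ x⌋₊ + 1 : ℝ)⁻¹) l (𝓝 0) := by
    simpa using ((hhd.comp hφ).abs).add hfloor
  have hinv : Tendsto (fun x => (D x * V x + h (φ x) * ν x + 1) / (h (φ x) ^ 2 * V x ^ 2)) l
      (𝓝[>] 0) := by
    refine tendsto_nhdsWithin_iff.2 ⟨?_, ?_⟩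
    · refine squeeze_zero' ?_ ?_ hsum
      · filter_upwards [hV, hν] with x hx hx'
        have := hh (φ x)
        have := hD0 x
        positivity
      · filter_upwards [hV, hν, hD, hh1, hq] with x hx hx' hDx hh1x hqx
        have hp := hh (φ x)
        have hn : (0 : ℝ) < ⌊φ x⌋₊ + 1 := by positivity
        have e1 : D x * V x / (h (φ x) ^ 2 * V x ^ 2) ≤ |deriv h (φ x) / h (φ x) ^ 2| := by
          rw [abs_div, abs_of_pos (pow_pos hp 2), div_le_div_iff₀ (by positivity) (by positivity)]
          nlinarith [mul_le_mul_of_nonneg_right hDx (by positivity : 0 ≤ V x * h (φ x) ^ 2)]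
        have e2 : (h (φ x) * ν x + 1) / (h (φ x) ^ 2 * V x ^ 2) ≤ (⌊φ x⌋₊ + 1 : ℝ)⁻¹ := by
          have e3 : (⌊φ x⌋₊ + 1 : ℝ) * (ν x + 1) ≤ h (φ x) * V x ^ 2 := by
            rwa [← mul_div_assoc, div_le_iff₀ (by positivity)] at hqx
          rw [inv_eq_one_div, div_le_div_iff₀ (by positivity) hn]
          have e4 := mul_le_mul_of_nonneg_left e3 hp.le
          nlinarith
        rw [add_assoc, add_div]
        exact add_le_add e1 e2
    · filter_upwards [hV, hν] with x hx hx'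
      have := hh (φ x)
      have := hD0 x
      simp only [mem_Ioi]
      positivity
  refine hinv.inv_tendsto_nhdsGT_zero.congr fun x => ?_
  simp only [Pi.inv_apply, inv_div]

/-- The primitive of a positive smooth function on the half line. -/
theorem exists_primitive {h : ℝ → ℝ} (hh : ContDiff ℝ ∞ h) (h0 : ∀ t, 0 < h t) {a : ℝ}
    (ha : 0 ≤ a) :
    ∃ s : ℝ → ℝ, ContDiffOn ℝ ∞ s (Ici 0) ∧ MapsTo s (Ici 0) (Ici 0) ∧
      (∀ r ∈ Ici (0 : ℝ), derivWithin s (Ici 0) r = h r) ∧ (∀ t, 0 ≤ t → a ≤ s t) ∧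
      ∀ t c, 1 ≤ t → (∀ r ∈ Icc (t - 1) t, c ≤ h r) → c ≤ s t := by
  have hder : ∀ t, HasDerivAt (fun t => a + ∫ r in (0)..t, h r) (h t) t := fun t =>
    (intervalIntegral.integral_hasDerivAt_right (hh.continuous.intervalIntegrable _ _)
      hh.continuous.stronglyMeasurable.stronglyMeasurableAtFilter
      hh.continuous.continuousAt).const_add _
  have hderiv : deriv (fun t => a + ∫ r in (0)..t, h r) = h := funext fun t => (hder t).deriv
  have hpos : ∀ t, 0 ≤ t → 0 ≤ ∫ r in (0)..t, h r := fun t ht =>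
    intervalIntegral.integral_nonneg ht fun r _ => (h0 r).le
  -- The constant `a` supplies a lower bound for small t. For t ≥ 1 the integral over the last unit
  -- interval alone already exceeds a lower bound of `h` there.
  refine ⟨fun t => a + ∫ r in (0)..t, h r, ?_, fun t ht => add_nonneg ha (hpos t ht),
    fun r hr => (hder r).hasDerivWithinAt.derivWithin (uniqueDiffOn_Ici 0 r hr),
    fun t ht => le_add_of_nonneg_right (hpos t ht), fun t c ht hc => ?_⟩
  · refine ContDiff.contDiffOn (contDiff_infty_iff_deriv.2
      ⟨fun t => (hder t).differentiableAt, ?_⟩)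
    rwa [hderiv]
  · have hi : ∀ u v, IntervalIntegrable h MeasureTheory.volume u v := fun u v =>
      hh.continuous.intervalIntegrable u v
    have h1 : c ≤ ∫ r in (t - 1)..t, h r := by
      have := intervalIntegral.integral_mono_on (by linarith) (intervalIntegrable_const (c := c))
        (hi (t - 1) t) hc
      simpa using this
    have h2 := hpos (t - 1) (by linarith)
    have h3 := intervalIntegral.integral_add_adjacent_intervals (hi 0 (t - 1)) (hi (t - 1) t)
    dsimp only
    linarith

/-! ### Derivatives along continuous families of tangent vectors -/

/-- The derivative is the fibre component of the tangent map, which is continuous on the tangent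
bundle over an open set where `f` is C¹. Base point and vector may thus vary together, as in the
Koszul terms and the Lie derivatives below. -/
theorem continuousAt_mvfderiv_comp {E : Type*} [NormedAddCommGroup E] [NormedSpace ℝ E]
    {H : Type*} [TopologicalSpace H] {I : ModelWithCorners ℝ E H}
    {M : Type*} [TopologicalSpace M] [ChartedSpace H M] [IsManifold I 1 M]
    {F : Type*} [NormedAddCommGroup F] [NormedSpace ℝ F]
    {N : Type*} [TopologicalSpace N] {f : M → F} {γ : N → TangentBundle I M} {y : N}
    (hf : ContMDiffAt I 𝓘(ℝ, F) 1 f (γ y).1) (hγ : ContinuousAt γ y) :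
    ContinuousAt (fun z => mvfderiv I f (γ z).1 (γ z).2) y := by
  obtain ⟨U, hU, hfU⟩ := (contMDiffAt_iff_contMDiffOn_nhds (by simp)).1 hf
  obtain ⟨W, hWU, hW, hyW⟩ := mem_nhds_iff.1 hU
  have h1 := (hfU.mono hWU).continuousOn_tangentMapWithin le_rfl hW.uniqueMDiffOn
  have hmem : π E (TangentSpace I) ⁻¹' W ∈ 𝓝 (γ y) :=
    (hW.preimage (FiberBundle.continuous_proj E (TangentSpace I))).mem_nhds hyW
  have h2 : ContinuousAt (tangentMapWithin I 𝓘(ℝ, F) f W) (γ y) := h1.continuousAt hmem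
  have h3 : ContinuousAt (fun z => (tangentBundleModelSpaceHomeomorph 𝓘(ℝ, F)
      (tangentMapWithin I 𝓘(ℝ, F) f W (γ z))).2) y :=
    continuous_snd.continuousAt.comp
      ((Homeomorph.continuous _).continuousAt.comp (h2.comp hγ))
  refine h3.congr ?_
  filter_upwards [hγ hmem] with z hz
  rw [tangentMapWithin_eq_tangentMap (hW.uniqueMDiffOn _ hz)]
  · rfl
  · exact ((hfU.mono hWU).contMDiffAt (hW.mem_nhds hz)).mdifferentiableAt (by simp)

/-! ### Local frames of normed vector bundles -/

section NormedBundle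

variable {EB : Type*} [NormedAddCommGroup EB] [NormedSpace ℝ EB]
  {B : Type*} [TopologicalSpace B] [ChartedSpace EB B]
  {F : Type*} [NormedAddCommGroup F] [NormedSpace ℝ F]
  {V : B → Type*} [TopologicalSpace (TotalSpace F V)]
  [∀ x, NormedAddCommGroup (V x)] [∀ x, NormedSpace ℝ (V x)]
  [FiberBundle F V] [VectorBundle ℝ F V]

variable (EB F V) in
/-- The norms of smooth local sections are continuous. -/
def HasContinuousNorm : Prop :=
  ∀ (U : Set B) (σ : Π x : B, V x), IsOpen U →
    ContMDiffOn 𝓘(ℝ, EB) (𝓘(ℝ, EB).prod 𝓘(ℝ, F)) ∞ (fun x => (⟨x, σ x⟩ : TotalSpace F V)) U →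
    ContinuousOn (fun x => ‖σ x‖) U

variable {ι : Type*} [Fintype ι]

theorem sum_repr_smul_localFrame (e : Trivialization F (π F V)) [MemTrivializationAtlas e]
    (b : Module.Basis ι ℝ F) {x : B} (hx : x ∈ e.baseSet) (v : V x) :
    ∑ i, b.repr (e ⟨x, v⟩).2 i • e.localFrame b i x = v := by
  have h := (e.basisAt b hx).sum_repr v
  simpa [Trivialization.basisAt, hx] using h

variable [ContMDiffVectorBundle ∞ F V 𝓘(ℝ, EB)]

/-- The fibre norm and the coordinate norm are uniformly equivalent near x₀. Continuity of the norms
of the frame sections gives one direction. For the other, ‖∑ yᵢeᵢ(x)‖ is continuous in x for fixed y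
and Lipschitz in y uniformly in x, so positivity at x₀ spreads over the compact unit sphere. -/
theorem HasContinuousNorm.exists_frame_bounds (hV : HasContinuousNorm EB F V)
    (b : Module.Basis ι ℝ F) (x₀ : B) :
    ∃ C : ℝ, 0 < C ∧ ∀ᶠ x in 𝓝 x₀,
      (∀ i, ‖(trivializationAt F V x₀).localFrame b i x‖ ≤ C) ∧
      ∀ (v : V x) (i : ι), |b.repr (trivializationAt F V x₀ ⟨x, v⟩).2 i| ≤ C * ‖v‖ := by
  classical
  set e := trivializationAt F V x₀ with he
  have hx₀ : x₀ ∈ e.baseSet := FiberBundle.mem_baseSet_trivializationAt' x₀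
  have hbase : ∀ᶠ x in 𝓝 x₀, x ∈ e.baseSet := e.open_baseSet.mem_nhds hx₀
  have hs : ∀ i, ContMDiffOn 𝓘(ℝ, EB) (𝓘(ℝ, EB).prod 𝓘(ℝ, F)) ∞
      (fun x => (⟨x, e.localFrame b i x⟩ : TotalSpace F V)) e.baseSet :=
    fun i => e.contMDiffOn_localFrame_baseSet ∞ b i
  have hN : ∀ y : ι → ℝ, ContinuousAt (fun x => ‖∑ i, y i • e.localFrame b i x‖) x₀ := fun y =>
    (hV e.baseSet (fun x => ∑ i, y i • e.localFrame b i x) e.open_baseSet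
      (ContMDiffOn.sum_section fun i _ => contMDiffOn_const.smul_section (hs i))).continuousAt
      (e.open_baseSet.mem_nhds hx₀)
  have hupper : ∃ C : ℝ, 0 < C ∧ ∀ᶠ x in 𝓝 x₀, ∀ i, ‖e.localFrame b i x‖ ≤ C := by
    refine ⟨∑ i, ‖e.localFrame b i x₀‖ + 1, by positivity, ?_⟩
    refine eventually_all.2 fun i => ?_
    have hc := (hV e.baseSet _ e.open_baseSet (hs i)).continuousAt (e.open_baseSet.mem_nhds hx₀)
    have hlt : ‖e.localFrame b i x₀‖ < ∑ i, ‖e.localFrame b i x₀‖ + 1 :=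
      (Finset.single_le_sum (f := fun i => ‖e.localFrame b i x₀‖)
        (fun _ _ => norm_nonneg _) (Finset.mem_univ i)).trans_lt (lt_add_one _)
    exact (hc.eventually_lt continuousAt_const hlt).mono fun x hx => hx.le
  obtain ⟨C, hC, hCx⟩ := hupper
  have hdiff : ∀ x, (∀ i, ‖e.localFrame b i x‖ ≤ C) → ∀ y z : ι → ℝ,
      ‖∑ i, z i • e.localFrame b i x‖ - ‖∑ i, y i • e.localFrame b i x‖ ≤
        Fintype.card ι * ‖y - z‖ * C := fun x hx y z => by
    refine (norm_sub_norm_le _ _).trans ?_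
    rw [← Finset.sum_sub_distrib]
    refine (norm_sum_le _ _).trans ((Finset.sum_le_card_nsmul _ _ (‖y - z‖ * C)
      fun i _ => ?_).trans_eq (by simp [mul_assoc]))
    rw [← sub_smul, norm_smul, norm_sub_rev]
    exact mul_le_mul (norm_le_pi_norm (y - z) i) (hx i) (norm_nonneg _) (norm_nonneg _)
  have hlower : ∃ δ : ℝ, 0 < δ ∧ ∀ᶠ x in 𝓝 x₀, ∀ y ∈ Metric.sphere (0 : ι → ℝ) 1,
      δ ≤ ‖∑ i, y i • e.localFrame b i x‖ := by
    refine (isCompact_sphere (0 : ι → ℝ) 1).induction_on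
      (p := fun T => ∃ δ : ℝ, 0 < δ ∧ ∀ᶠ x in 𝓝 x₀, ∀ y ∈ T,
        δ ≤ ‖∑ i, y i • e.localFrame b i x‖) ⟨1, one_pos, by simp⟩ ?_ ?_ ?_
    · rintro S T hST ⟨δ, hδ, h⟩
      exact ⟨δ, hδ, h.mono fun x hx y hy => hx y (hST hy)⟩
    · rintro S T ⟨δ, hδ, h⟩ ⟨δ', hδ', h'⟩
      refine ⟨min δ δ', lt_min hδ hδ', ?_⟩
      filter_upwards [h, h'] with x hx hx' y hy
      exact hy.elim (fun hy => (min_le_left _ _).trans (hx y hy))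
        fun hy => (min_le_right _ _).trans (hx' y hy)
    · intro y hy
      have hpos : 0 < ‖∑ i, y i • e.localFrame b i x₀‖ := by
        refine norm_pos_iff.2 fun h => ?_
        have hli := (e.basisAt b hx₀).linearIndependent
        have h0 := Fintype.linearIndependent_iff.1 hli y (by simpa [hx₀] using h)
        have : y = 0 := funext h0
        simp [this] at hy
      set N := ‖∑ i, y i • e.localFrame b i x₀‖
      -- With Lipschitz constant card ι · C, moving y by this radius costs at most N/4, so a norm
      -- above N/2 stays above N/4.
      have hr : 0 < N / 4 / (Fintype.card ι * C + 1) := by positivity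
      refine ⟨_, mem_nhdsWithin_of_mem_nhds (Metric.ball_mem_nhds y hr), N / 4, by positivity, ?_⟩
      filter_upwards [hCx, continuousAt_const.eventually_lt (hN y) (half_lt_self hpos)]
        with x hx hxN z hz
      have h1 := hdiff x hx z y
      have h2 : Fintype.card ι * ‖z - y‖ * C ≤ N / 4 := by
        have h3 : ‖z - y‖ ≤ N / 4 / (Fintype.card ι * C + 1) := by
          rw [← dist_eq_norm]; exact (Metric.mem_ball.1 hz).le
        rw [le_div_iff₀ (by positivity)] at h3
        nlinarith [norm_nonneg (z - y)]
      linarith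
  obtain ⟨δ, hδ, hδx⟩ := hlower
  refine ⟨max C δ⁻¹, lt_max_of_lt_left hC, ?_⟩
  filter_upwards [hCx, hδx, hbase] with x h1 h2 hx
  refine ⟨fun i => (h1 i).trans (le_max_left _ _), fun v i => ?_⟩
  set y : ι → ℝ := fun i => b.repr (e ⟨x, v⟩).2 i with hy
  have hv : ∑ i, y i • e.localFrame b i x = v := sum_repr_smul_localFrame e b hx v
  have hyv : ‖y‖ ≤ δ⁻¹ * ‖v‖ := by
    rcases eq_or_ne y 0 with h0 | h0
    · rw [h0, norm_zero]; positivity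
    · have hy0 : 0 < ‖y‖ := norm_pos_iff.2 h0
      have h3 := h2 (‖y‖⁻¹ • y) (by simp [norm_smul, hy0.ne'])
      have h4 : ∑ i, (‖y‖⁻¹ • y) i • e.localFrame b i x = ‖y‖⁻¹ • v := by
        rw [← hv, Finset.smul_sum]
        simp [mul_smul]
      rw [h4, norm_smul, norm_inv, norm_norm, ← div_eq_inv_mul, le_div_iff₀ hy0] at h3
      rwa [inv_mul_eq_div, le_div_iff₀' hδ]
  calc |y i| ≤ ‖y‖ := norm_le_pi_norm y i
    _ ≤ δ⁻¹ * ‖v‖ := hyv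
    _ ≤ max C δ⁻¹ * ‖v‖ := by gcongr; exact le_max_right _ _

end NormedBundle

/-! ### Local bounds for the Levi-Civita connection -/

section LeviCivitaBounds

variable {E : Type*} [NormedAddCommGroup E] [NormedSpace ℝ E] [FiniteDimensional ℝ E]
  {M : Type*} [TopologicalSpace M] [ChartedSpace E M] [IsManifold 𝓘(ℝ, E) ∞ M]
  [RiemannianBundle (fun x : M => TangentSpace 𝓘(ℝ, E) x)]
  [IsContMDiffRiemannianBundle 𝓘(ℝ, E) ∞ E (fun x : M => TangentSpace 𝓘(ℝ, E) x)]

theorem contMDiffAt_inner {X Y : Π x : M, TangentSpace 𝓘(ℝ, E) x} {x : M}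
    (hX : CMDiffAt 2 (T% X) x) (hY : CMDiffAt 2 (T% Y) x) :
    ContMDiffAt 𝓘(ℝ, E) 𝓘(ℝ, ℝ) 2 (fun y => (inner ℝ (X y) (Y y) : ℝ)) x :=
  ContMDiffAt.inner_bundle (F := E) (E := fun x : M => TangentSpace 𝓘(ℝ, E) x)
    (b := fun y => y) hX hY

theorem continuousAt_inner {X Y : Π x : M, TangentSpace 𝓘(ℝ, E) x} {x : M}
    (hX : ContinuousAt (T% X) x) (hY : ContinuousAt (T% Y) x) :
    ContinuousAt (fun y => (inner ℝ (X y) (Y y) : ℝ)) x := by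
  obtain ⟨g, hg, hg'⟩ := ‹IsContMDiffRiemannianBundle 𝓘(ℝ, E) ∞ E
    (fun x : M => TangentSpace 𝓘(ℝ, E) x)›.exists_contMDiff
  have : IsContinuousRiemannianBundle E (fun x : M => TangentSpace 𝓘(ℝ, E) x) :=
    ⟨g, hg.continuous, hg'⟩
  exact ContinuousAt.inner_bundle (F := E) (E := fun x : M => TangentSpace 𝓘(ℝ, E) x)
    (b := fun y => y) hX hY

theorem continuousAt_norm {X : Π x : M, TangentSpace 𝓘(ℝ, E) x} {x : M}
    (hX : ContinuousAt (T% X) x) : ContinuousAt (fun y => ‖X y‖) x := by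
  simp_rw [norm_eq_sqrt_real_inner]
  exact Real.continuous_sqrt.continuousAt.comp (continuousAt_inner hX hX)

theorem hasContinuousNorm_tangent :
    HasContinuousNorm E E (fun x : M => TangentSpace 𝓘(ℝ, E) x) := fun _ _ hU hσ _ hx =>
  (continuousAt_norm ((hσ.contMDiffAt (hU.mem_nhds hx)).continuousAt)).continuousWithinAt

theorem continuousAt_koszul {X Y Z : Π x : M, TangentSpace 𝓘(ℝ, E) x} {x : M}
    (hX : CMDiffAt 2 (T% X) x) (hY : CMDiffAt 2 (T% Y) x) (hZ : CMDiffAt 2 (T% Z) x) :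
    ContinuousAt (koszul X Y Z) x := by
  have := FiniteDimensional.complete ℝ E
  have hm : minSmoothness ℝ (((1 : ℕ∞) : ℕ∞ω) + 1) ≤ ((2 : ℕ∞) : ℕ∞ω) := by
    rw [minSmoothness_of_isRCLikeNormedField]; norm_num
  have hM : IsManifold 𝓘(ℝ, E) (minSmoothness ℝ 2) M := by
    rw [minSmoothness_of_isRCLikeNormedField]; exact .of_le (n := ∞) ENat.LEInfty.out
  have hM' : IsManifold 𝓘(ℝ, E) (((2 : ℕ∞) : ℕ∞ω) + 1) M :=
    .of_le (n := ∞) (WithTop.coe_le_coe.2 (le_top : (2 + 1 : ℕ∞) ≤ ⊤))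
  have hd : ∀ {U V W : Π x : M, TangentSpace 𝓘(ℝ, E) x}, CMDiffAt 2 (T% U) x →
      CMDiffAt 2 (T% V) x → CMDiffAt 2 (T% W) x →
      ContinuousAt (fun y => mvfderiv 𝓘(ℝ, E) (fun z => (inner ℝ (U z) (V z) : ℝ)) y (W y)) x :=
    fun {U V W} hU hV hW => continuousAt_mvfderiv_comp (γ := T% W)
      ((contMDiffAt_inner hU hV).of_le (by norm_num)) hW.continuousAt
  have hb : ∀ {U V W : Π x : M, TangentSpace 𝓘(ℝ, E) x}, CMDiffAt 2 (T% U) x →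
      CMDiffAt 2 (T% V) x → CMDiffAt 2 (T% W) x →
      ContinuousAt (fun y => (inner ℝ (VectorField.mlieBracket 𝓘(ℝ, E) U V y) (W y) : ℝ)) x :=
    fun {U V W} hU hV hW => continuousAt_inner
      (ContMDiffAt.mlieBracket_vectorField (m := 1) (n := 2) hU hV hm).continuousAt
      hW.continuousAt
  exact (((((hd hY hZ hX).add (hd hX hZ hY)).sub (hd hX hY hZ)).add (hb hX hY hZ)).sub
    (hb hX hZ hY)).sub (hb hY hZ hX)

/-- In a local frame the numbers ⟨∇_{eᵢ}Y, eⱼ⟩ are Koszul expressions, continuous and hence locally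
bounded; frame coordinates are controlled by the Riemannian norm. -/
theorem exists_norm_leviCivita_le {Y : Π x : M, TangentSpace 𝓘(ℝ, E) x} {x₀ : M}
    (hY : CMDiffAt 2 (T% Y) x₀) : ∃ C : ℝ, ∀ᶠ x in 𝓝 x₀, ‖leviCivita Y x‖ ≤ C := by
  let b := Module.finBasis ℝ E
  set e := trivializationAt E (fun x : M => TangentSpace 𝓘(ℝ, E) x) x₀ with he
  have hx₀ : x₀ ∈ e.baseSet := FiberBundle.mem_baseSet_trivializationAt' x₀
  obtain ⟨C, hC, hCx⟩ := (hasContinuousNorm_tangent (E := E) (M := M)).exists_frame_bounds b x₀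
  have hs : ∀ i, ∀ x ∈ e.baseSet, CMDiffAt 2 (T% (e.localFrame b i)) x := fun i x hx =>
    contMDiffAt_localFrame_of_mem 2 e b i hx
  set K : ℝ := ∑ i, ∑ j, (|koszul (e.localFrame b i) Y (e.localFrame b j) x₀ / 2| + 1) with hK
  have hKx : ∀ᶠ x in 𝓝 x₀, ∀ i j,
      |koszul (e.localFrame b i) Y (e.localFrame b j) x / 2| ≤ K := by
    refine eventually_all.2 fun i => eventually_all.2 fun j => ?_
    have hc : ContinuousAt (fun x => |koszul (e.localFrame b i) Y (e.localFrame b j) x / 2|) x₀ :=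
      ((continuousAt_koszul (hs i x₀ hx₀) hY (hs j x₀ hx₀)).div_const 2).abs
    have hle : |koszul (e.localFrame b i) Y (e.localFrame b j) x₀ / 2| + 1 ≤ K :=
      (Finset.single_le_sum (f := fun j => |koszul (e.localFrame b i) Y (e.localFrame b j) x₀ / 2|
        + 1) (fun _ _ => by positivity) (Finset.mem_univ j)).trans
        (Finset.single_le_sum (f := fun i => ∑ j,
          (|koszul (e.localFrame b i) Y (e.localFrame b j) x₀ / 2| + 1))
          (fun _ _ => by positivity) (Finset.mem_univ i))
    exact (hc.eventually_lt continuousAt_const ((lt_add_one _).trans_le hle)).mono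
      fun x hx => hx.le
  have hK0 : 0 ≤ K := by positivity
  have hYx : ∀ᶠ x in 𝓝 x₀, MDiffAt (T% Y) x := ((contMDiffAt_iff_contMDiffAt_nhds (by simp)).1 hY).mono fun x hx =>
    hx.mdifferentiableAt (by simp)
  refine ⟨∑ _i : Fin (Module.finrank ℝ E), ∑ _j : Fin (Module.finrank ℝ E), C * (C * K), ?_⟩
  filter_upwards [hCx, hKx, hYx, e.open_baseSet.mem_nhds hx₀] with x hx1 hx2 hx3 hx
  refine ContinuousLinearMap.opNorm_le_bound _ (by positivity) fun w => ?_
  set z := leviCivita Y x w with hz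
  have key : ∀ w z : TangentSpace 𝓘(ℝ, E) x, inner ℝ (leviCivita Y x w) z ≤
      (∑ _i : Fin (Module.finrank ℝ E), ∑ _j : Fin (Module.finrank ℝ E), C * (C * K))
        * ‖w‖ * ‖z‖ := fun w z => by
    have hw := sum_repr_smul_localFrame e b hx w
    have hz := sum_repr_smul_localFrame e b hx z
    conv_lhs => rw [← hw, ← hz]
    simp only [map_sum, map_smul, sum_inner, inner_sum, real_inner_smul_left,
      real_inner_smul_right, Finset.sum_mul]
    rw [Finset.sum_comm]
    refine Finset.sum_le_sum fun i _ => Finset.sum_le_sum fun j _ => ?_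
    rw [inner_leviCivita ((hs i x hx).mdifferentiableAt (by simp)) hx3
      ((hs j x hx).mdifferentiableAt (by simp))]
    refine (le_abs_self _).trans ?_
    rw [abs_mul, abs_mul]
    calc _ ≤ (C * ‖z‖) * ((C * ‖w‖) * K) := by
          gcongr
          · exact hx1.2 z j
          · exact hx1.2 w i
          · exact hx2 i j
      _ = _ := by ring
  -- Pairing ∇_wY with itself and cancelling one factor of its norm bounds the operator.
  have h := key w z
  rw [← hz, real_inner_self_eq_norm_mul_norm] at h
  rcases (norm_nonneg z).eq_or_lt with h0 | h0
  · rw [← h0]; positivity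
  · exact le_of_mul_le_mul_right h h0

/-- Torsion-freeness is known only after pairing with a differentiable field; it is tested against
an extension of the difference vector itself. -/
theorem leviCivita_eq_mlieBracket_add {X Y : Π x : M, TangentSpace 𝓘(ℝ, E) x} {x : M}
    (hX : MDiffAt (T% X) x) (hY : MDiffAt (T% Y) x) :
    leviCivita Y x (X x) - VectorField.mlieBracket 𝓘(ℝ, E) X Y x = leviCivita X x (Y x) := by
  rw [← sub_eq_zero]
  set w := leviCivita Y x (X x) - VectorField.mlieBracket 𝓘(ℝ, E) X Y x - leviCivita X x (Y x)
    with hw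
  have h := leviCivita_torsion_free hX hY
    (FiberBundle.mdifferentiableAt_extend 𝓘(ℝ, E) E (V := fun x : M => TangentSpace 𝓘(ℝ, E) x) w)
  rw [FiberBundle.extend_apply_self, sub_right_comm, ← hw] at h
  exact inner_self_eq_zero.1 h

end LeviCivitaBounds

/-! ### The fundamental vector fields -/

section FundamentalField

variable {EM : Type*} [NormedAddCommGroup EM] [NormedSpace ℂ EM]
  {M : Type*} [TopologicalSpace M] [ChartedSpace EM M]
  {EG : Type*} [NormedAddCommGroup EG] [NormedSpace ℝ EG]
  {G : Type*} [TopologicalSpace G] [ChartedSpace EG G] [Group G] [MulAction G M]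

theorem isLinearMap_fundamentalField (x : M) :
    IsLinearMap ℝ (fun u : LieAlg EG G => fundamentalField (EM := EM) u x) :=
  let L : EG →L[ℝ] EM := mfderiv 𝓘(ℝ, EG) 𝓘(ℝ, EM) (fun g : G => g • x) 1
  ⟨fun u u' => L.map_add u u', fun c u => L.map_smul c u⟩

theorem fundamentalField_add (u u' : LieAlg EG G) :
    fundamentalField (EM := EM) (M := M) (u + u') = fundamentalField u + fundamentalField u' :=
  funext fun x => (isLinearMap_fundamentalField x).map_add u u'

theorem fundamentalField_smul (c : ℝ) (u : LieAlg EG G) :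
    fundamentalField (EM := EM) (M := M) (c • u) = c • fundamentalField u :=
  funext fun x => (isLinearMap_fundamentalField x).map_smul c u

theorem fundamentalField_sum {ι : Type*} (s : Finset ι) (c : ι → ℝ) (u : ι → LieAlg EG G) (x : M) :
    fundamentalField (EM := EM) (∑ i ∈ s, c i • u i) x =
      ∑ i ∈ s, c i • fundamentalField (EM := EM) (u i) x := by
  have h := map_sum (isLinearMap_fundamentalField (EM := EM) (EG := EG) (G := G) x).mk'
    (fun i => c i • u i) s
  simpa only [IsLinearMap.mk'_apply, (isLinearMap_fundamentalField x).map_smul] using h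

variable [IsManifold 𝓘(ℂ, EM) ω M] [IsManifold 𝓘(ℝ, EG) ∞ G]
  [ContMDiffSMul 𝓘(ℝ, EG) 𝓘(ℝ, EM) ∞ G M]

/-- The field is the tangent map of the action G × M → M applied to (u, 0) over (1, x), which
depends smoothly on x. -/
theorem contMDiff_fundamentalField (u : LieAlg EG G) :
    ContMDiff 𝓘(ℝ, EM) 𝓘(ℝ, EM).tangent ∞
      (fun x : M => (⟨x, fundamentalField u x⟩ : TangentBundle 𝓘(ℝ, EM) M)) := by
  have hM1 : IsManifold 𝓘(ℝ, EM) (∞ + 1) M := isManifold_real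
  have hG1 : IsManifold 𝓘(ℝ, EG) (∞ + 1) G := ‹IsManifold 𝓘(ℝ, EG) ∞ G›
  have hsmul : ContMDiff (𝓘(ℝ, EG).prod 𝓘(ℝ, EM)) 𝓘(ℝ, EM) ∞ (fun p : G × M => p.1 • p.2) :=
    ContMDiffSMul.contMDiff_smul
  have h1 : ContMDiff 𝓘(ℝ, EM) (𝓘(ℝ, EG).tangent.prod 𝓘(ℝ, EM).tangent) ∞
      (fun x : M => ((⟨1, u⟩ : TangentBundle 𝓘(ℝ, EG) G),
        (⟨x, 0⟩ : TangentBundle 𝓘(ℝ, EM) M))) :=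
    contMDiff_const.prodMk (contMDiff_zeroSection ℝ (TangentSpace 𝓘(ℝ, EM)))
  have h2 : ContMDiff (𝓘(ℝ, EG).tangent.prod 𝓘(ℝ, EM).tangent) _ ∞
      (equivTangentBundleProd 𝓘(ℝ, EG) G 𝓘(ℝ, EM) M).symm :=
    contMDiff_equivTangentBundleProd_symm
  have h3 := hsmul.contMDiff_tangentMap (m := ∞) le_rfl
  refine ((h3.comp h2).comp h1).congr fun x => ?_
  have hd : mfderiv (𝓘(ℝ, EG).prod 𝓘(ℝ, EM)) 𝓘(ℝ, EM) (fun p : G × M => p.1 • p.2) (1, x)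
      ((u, 0) : EG × EM) = fundamentalField (EM := EM) u x := by
    have h := mfderiv_prod_eq_add_apply (p := ((1, x) : G × M)) (v := ((u, 0) : EG × EM))
      (hsmul.mdifferentiableAt (x := ((1, x) : G × M)) (by simp))
    refine h.trans ?_
    exact (congrArg _ (ContinuousLinearMap.map_zero _)).trans (add_zero _)
  -- The tangent map lands over 1 • x, which equals x only propositionally.
  have hmk : ∀ (y : M) (w : EM), y = x →
      (⟨x, w⟩ : TangentBundle 𝓘(ℝ, EM) M) = ⟨y, w⟩ := fun y w h => by subst h; rfl
  simp only [Function.comp_apply, tangentMap]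
  exact (hmk _ _ (one_smul G x)).trans (congrArg _ hd.symm)

end FundamentalField

/-! ### The taming field and the moment of the Levi-Civita connection -/

section ScalarProduct

variable {EG : Type*} [NormedAddCommGroup EG] [NormedSpace ℝ EG] [FiniteDimensional ℝ EG]
  {G : Type*} [TopologicalSpace G] [ChartedSpace EG G] [Group G]

/-- The isomorphism `ψ : 𝔤* → 𝔤` as a continuous linear map. -/
def InvariantScalarProduct.psiL (B : InvariantScalarProduct EG G) :
    LieCoalg EG G →L[ℝ] LieAlg EG G :=
  LinearMap.toContinuousLinearMap
    { toFun := B.psi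
      map_add' := fun η η' => by
        refine (Module.forall_dual_apply_eq_zero_iff ℝ _).1 (fun ξ => ?_) |> sub_eq_zero.1
        have h := B.apply_psi (LinearMap.toContinuousLinearMap ξ)
        simp only [LinearMap.coe_toContinuousLinearMap'] at h
        simp [h]
      map_smul' := fun c η => by
        refine (Module.forall_dual_apply_eq_zero_iff ℝ _).1 (fun ξ => ?_) |> sub_eq_zero.1
        have h := B.apply_psi (LinearMap.toContinuousLinearMap ξ)
        simp only [LinearMap.coe_toContinuousLinearMap'] at h
        simp [h] }

/-- The scalar product as a continuous bilinear map. -/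
def InvariantScalarProduct.formL (B : InvariantScalarProduct EG G) :
    LieCoalg EG G →L[ℝ] LieCoalg EG G →L[ℝ] ℝ :=
  B.form.toContinuousBilinearMap

theorem InvariantScalarProduct.hasFDerivAt_half (B : InvariantScalarProduct EG G)
    (ξ : LieCoalg EG G) : HasFDerivAt (fun ξ => B.form ξ ξ / 2) (B.formL ξ) ξ := by
  have h := (B.formL.hasFDerivAt_of_bilinear (hasFDerivAt_id ξ) (hasFDerivAt_id ξ)).mul_const (2⁻¹ : ℝ)
  refine (h.congr_fderiv ?_ : HasFDerivAt _ (B.formL ξ) ξ)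
  ext η
  have h1 : B.formL ξ η = B.form ξ η := rfl
  have h2 : B.formL η ξ = B.form ξ η := B.symm η ξ
  simp [h1, h2]
  ring

theorem InvariantScalarProduct.form_self_nonneg (B : InvariantScalarProduct EG G)
    (ξ : LieCoalg EG G) : 0 ≤ B.form ξ ξ := by
  rcases eq_or_ne ξ 0 with rfl | h
  · simp
  · exact (B.pos ξ h).le

/-- By homogeneity and compactness of the unit sphere, a positive definite form dominates a multiple
of the squared norm. -/
theorem InvariantScalarProduct.tendsto_form_self (B : InvariantScalarProduct EG G) :
    Tendsto (fun ξ => B.form ξ ξ / 2) (cocompact (LieCoalg EG G)) atTop := by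
  have hcont : Continuous fun ξ => B.form ξ ξ / 2 :=
    (continuous_iff_continuousAt.2 fun ξ => (B.hasFDerivAt_half ξ).continuousAt)
  have hpos : ∃ δ : ℝ, 0 < δ ∧ ∀ ξ ∈ Metric.sphere (0 : LieCoalg EG G) 1, δ ≤ B.form ξ ξ / 2 := by
    -- The sphere is empty when 𝔤 = 0.
    rcases (Metric.sphere (0 : LieCoalg EG G) 1).eq_empty_or_nonempty with h | h
    · exact ⟨1, one_pos, by simp [h]⟩
    · have := FiniteDimensional.proper ℝ (LieCoalg EG G)
      obtain ⟨ξ, hξ, hmin⟩ := (isCompact_sphere (0 : LieCoalg EG G) 1).exists_isMinOn h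
        hcont.continuousOn
      refine ⟨_, half_pos (B.pos ξ ?_), fun η hη => hmin hη⟩
      rintro rfl
      simp at hξ
  obtain ⟨δ, hδ, hδ'⟩ := hpos
  have hle : ∀ ξ : LieCoalg EG G, δ * ‖ξ‖ ^ 2 ≤ B.form ξ ξ / 2 := fun ξ => by
    rcases eq_or_ne ξ 0 with rfl | h
    · simp
    · have hn : 0 < ‖ξ‖ := norm_pos_iff.2 h
      have h1 := hδ' (‖ξ‖⁻¹ • ξ) (by simp [norm_smul, hn.ne'])
      simp only [map_smul, LinearMap.smul_apply, smul_eq_mul] at h1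
      calc δ * ‖ξ‖ ^ 2 ≤ (‖ξ‖⁻¹ * (‖ξ‖⁻¹ * B.form ξ ξ) / 2) * ‖ξ‖ ^ 2 := by gcongr
        _ = B.form ξ ξ / 2 := by field_simp
  refine tendsto_atTop_mono hle (Tendsto.const_mul_atTop hδ ?_)
  exact (tendsto_pow_atTop two_ne_zero).comp tendsto_norm_cocompact_atTop

end ScalarProduct

section Taming

variable {EM : Type*} [NormedAddCommGroup EM] [NormedSpace ℂ EM] [FiniteDimensional ℂ EM]
  {M : Type*} [TopologicalSpace M] [ChartedSpace EM M] [IsManifold 𝓘(ℂ, EM) ω M]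
  {EG : Type*} [NormedAddCommGroup EG] [NormedSpace ℝ EG] [FiniteDimensional ℝ EG]
  {G : Type*} [TopologicalSpace G] [ChartedSpace EG G] [Group G] [MulAction G M]
  [RiemannianBundle (fun x : M => TangentSpace 𝓘(ℝ, EM) x)]
  {B : InvariantScalarProduct EG G} {μ : M → LieCoalg EG G} {U : Set M}

theorem J_J (x : M) (w : TangentSpace 𝓘(ℝ, EM) x) : J x (J x w) = -w := by
  have h : ∀ w : EM, Complex.I • Complex.I • w = -w := fun w => by
    rw [smul_smul, Complex.I_mul_I, neg_one_smul]
  exact h w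

theorem IsHermitianMetric.norm_J (hM : IsHermitianMetric EM M) (x : M)
    (w : TangentSpace 𝓘(ℝ, EM) x) : ‖J x w‖ = ‖w‖ := by
  rw [norm_eq_sqrt_real_inner, norm_eq_sqrt_real_inner, hM, J_J, inner_neg_right, neg_neg]

/-- `J` is skew with square -1, hence isometric. This identity turns |df||v| into a multiple of
|v|². -/
theorem IsHermitianMetric.norm_tamingField (hM : IsHermitianMetric EM M) (x : M) :
    ‖tamingField (EM := EM) B μ x‖ = ‖mvfderiv 𝓘(ℝ, EM) (halfNormSq B μ) x‖ := by
  rw [tamingField, norm_neg, hM.norm_J, grad, LinearIsometryEquiv.norm_map]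

theorem IsMomentMapOn.mdifferentiableAt (hμ : IsMomentMapOn (EM := EM) U μ) (hU : IsOpen U) {x : M}
    (hx : x ∈ U) : MDifferentiableAt 𝓘(ℝ, EM) 𝓘(ℝ, LieCoalg EG G) μ x :=
  (hμ.smooth.contMDiffAt (hU.mem_nhds hx)).mdifferentiableAt (by simp)

theorem IsMomentMapOn.mdifferentiableAt_halfNormSq (hμ : IsMomentMapOn (EM := EM) U μ)
    (hU : IsOpen U) {x : M} (hx : x ∈ U) :
    MDifferentiableAt 𝓘(ℝ, EM) 𝓘(ℝ, ℝ) (halfNormSq B μ) x :=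
  (B.hasFDerivAt_half (μ x)).differentiableAt.mdifferentiableAt.comp x
    (hμ.mdifferentiableAt hU hx)

/-- The derivative of |μ|²/2 is ⟨μ, dμ⟩, that is, dμ evaluated on the vector ψ(μ(x)) frozen at x;
the moment map equation applies to this fixed vector. -/
theorem IsMomentMapOn.mvfderiv_halfNormSq (hμ : IsMomentMapOn (EM := EM) U μ) (hU : IsOpen U)
    {x : M} (hx : x ∈ U) (w : TangentSpace 𝓘(ℝ, EM) x) :
    mvfderiv 𝓘(ℝ, EM) (halfNormSq B μ) x w =
      kahlerForm x (fundamentalField (B.psi (μ x)) x) w := by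
  have hd := hμ.mdifferentiableAt hU hx
  have h1 : mvfderiv 𝓘(ℝ, EM) (halfNormSq B μ) x w =
      B.formL (μ x) (mvfderiv 𝓘(ℝ, EM) μ x w) := by
    have h := (B.hasFDerivAt_half (μ x)).hasMFDerivAt.comp x hd.hasMFDerivAt
    exact congrArg (fun L : TangentSpace 𝓘(ℝ, EM) x →L[ℝ] ℝ => L w) h.mfderiv
  rw [h1, ← hμ.deriv_eq _ x hx]
  have h2 : mvfderiv 𝓘(ℝ, EM) (fun y => μ y (B.psi (μ x))) x w =
      (mvfderiv 𝓘(ℝ, EM) μ x w) (B.psi (μ x)) := by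
    have h := ((ContinuousLinearMap.apply ℝ ℝ (B.psi (μ x))).hasFDerivAt
      (x := μ x)).hasMFDerivAt.comp x hd.hasMFDerivAt
    exact congrArg (fun L : TangentSpace 𝓘(ℝ, EM) x →L[ℝ] ℝ => L w) h.mfderiv
  rw [h2, B.apply_psi]
  exact B.symm _ _

/-- Where `μ` is a moment map, the taming field at `x` is the fundamental field of `ψ (μ x)`. -/
theorem IsMomentMapOn.tamingField_eq (hμ : IsMomentMapOn (EM := EM) U μ) (hU : IsOpen U)
    {x : M} (hx : x ∈ U) :
    tamingField (EM := EM) B μ x = fundamentalField (B.psi (μ x)) x := by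
  have h : grad (halfNormSq B μ) x = J x (fundamentalField (EM := EM) (B.psi (μ x)) x) := by
    refine ext_inner_right ℝ fun w => ?_
    rw [grad, InnerProductSpace.toDual_symm_apply, hμ.mvfderiv_halfNormSq hU hx]
    rfl
  rw [tamingField, h, J_J, neg_neg]

variable [IsManifold 𝓘(ℝ, EG) ∞ G] [ContMDiffSMul 𝓘(ℝ, EG) 𝓘(ℝ, EM) ∞ G M]

/-- In a basis (bᵢ) of 𝔤 the field is a combination of the smooth fields (bᵢ)_M, with the
coordinates of ψ(μ) as smooth coefficients. -/
theorem IsMomentMapOn.contMDiffOn_tamingField (hμ : IsMomentMapOn (EM := EM) U μ)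
    (hU : IsOpen U) :
    ContMDiffOn 𝓘(ℝ, EM) 𝓘(ℝ, EM).tangent ∞
      (fun x : M => (⟨x, tamingField B μ x⟩ : TangentBundle 𝓘(ℝ, EM) M)) U := by
  let b := Module.finBasis ℝ (LieAlg EG G)
  have hc : ∀ i, ContMDiffOn 𝓘(ℝ, EM) 𝓘(ℝ, ℝ) ∞ (fun x => b.coord i (B.psi (μ x))) U := fun i =>
    ((LinearMap.toContinuousLinearMap (b.coord i)).comp B.psiL).contMDiff.comp_contMDiffOn hμ.smooth
  have hs : ContMDiffOn 𝓘(ℝ, EM) 𝓘(ℝ, EM).tangent ∞ (fun x : M => (⟨x, ∑ i,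
      b.coord i (B.psi (μ x)) • fundamentalField (b i) x⟩ : TangentBundle 𝓘(ℝ, EM) M)) U :=
    ContMDiffOn.sum_section fun i _ =>
      (hc i).smul_section (contMDiff_fundamentalField (b i)).contMDiffOn
  refine hs.congr fun x hx => ?_
  rw [hμ.tamingField_eq hU hx, ← fundamentalField_sum]
  congr 2
  exact (b.sum_repr _).symm

variable [IsContMDiffRiemannianBundle 𝓘(ℝ, EM) ∞ EM (fun x : M => TangentSpace 𝓘(ℝ, EM) x)]

/-- ∇_{u_M}Y - [u_M, Y] = ∇_Y u_M by vanishing torsion, so the auxiliary extension of `w` disappears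
and the local bound for `leviCivita` applies. -/
theorem tangentMoment_eq_leviCivita (u : LieAlg EG G) (x : M) (w : TangentSpace 𝓘(ℝ, EM) x) :
    tangentMoment u x w = leviCivita (fundamentalField u) x w := by
  have h := leviCivita_eq_mlieBracket_add
    ((contMDiff_fundamentalField u).mdifferentiableAt (x := x) (by simp))
    (FiberBundle.mdifferentiableAt_extend 𝓘(ℝ, EM) EM
      (V := fun x : M => TangentSpace 𝓘(ℝ, EM) x) w)
  rw [FiberBundle.extend_apply_self] at h
  exact h

theorem isLinearMap_tangentMoment (x : M) (w : TangentSpace 𝓘(ℝ, EM) x) :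
    IsLinearMap ℝ (fun u : LieAlg EG G => tangentMoment u x w) where
  map_add u u' := by
    simp only [tangentMoment, fundamentalField_add]
    rw [VectorField.mlieBracket_add_left
      ((contMDiff_fundamentalField u).mdifferentiableAt (by simp))
      ((contMDiff_fundamentalField u').mdifferentiableAt (by simp)), Pi.add_apply, map_add]
    abel
  map_smul c u := by
    simp only [tangentMoment, fundamentalField_smul]
    rw [VectorField.mlieBracket_const_smul_left
      ((contMDiff_fundamentalField u).mdifferentiableAt (by simp)), Pi.smul_apply, map_smul,
      smul_sub]

theorem exists_tangentMoment_le (u : LieAlg EG G) (x₀ : M) :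
    ∃ C : ℝ, ∀ᶠ x in 𝓝 x₀, ∀ w : TangentSpace 𝓘(ℝ, EM) x, ‖tangentMoment u x w‖ ≤ C * ‖w‖ := by
  have hX : ContMDiffAt 𝓘(ℝ, EM) 𝓘(ℝ, EM).tangent 2
      (fun x : M => (⟨x, fundamentalField u x⟩ : TangentBundle 𝓘(ℝ, EM) M)) x₀ :=
    (contMDiff_fundamentalField u).contMDiffAt.of_le ENat.LEInfty.out
  obtain ⟨C, hC⟩ := exists_norm_leviCivita_le hX
  refine ⟨C, ?_⟩
  filter_upwards [hC] with x hx
  intro w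
  have h := (leviCivita (fundamentalField (EM := EM) (M := M) u) x).le_opNorm w
  rw [tangentMoment_eq_leviCivita]
  refine h.trans ?_
  exact (mul_le_mul_of_nonneg_right hx (norm_nonneg w))

end Taming

/-- A linear family of locally bounded fields of endomorphisms is locally bounded along a
continuous family of parameters. -/
theorem exists_bound_of_linear_family {X : Type*} [TopologicalSpace X] {V : X → Type*}
    [∀ x, NormedAddCommGroup (V x)] [∀ x, NormedSpace ℝ (V x)]
    {L : Type*} [NormedAddCommGroup L] [NormedSpace ℝ L] [FiniteDimensional ℝ L]
    {T : L → Π x, V x → V x} (hT : ∀ x w, IsLinearMap ℝ fun u => T u x w) {x₀ : X}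
    (hb : ∀ u, ∃ C : ℝ, ∀ᶠ x in 𝓝 x₀, ∀ w, ‖T u x w‖ ≤ C * ‖w‖) {u : X → L}
    (hu : ContinuousAt u x₀) :
    ∃ C : ℝ, 0 ≤ C ∧ ∀ᶠ x in 𝓝 x₀, ∀ w, ‖T (u x) x w‖ ≤ C * ‖w‖ := by
  let b := Module.finBasis ℝ L
  choose C hC using fun i => hb (b i)
  have hc : ∀ᶠ x in 𝓝 x₀, ∀ i, |b.coord i (u x)| ≤ |b.coord i (u x₀)| + 1 :=
    eventually_all.2 fun i =>
      ((((LinearMap.toContinuousLinearMap (b.coord i)).continuous.continuousAt.comp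
        hu).abs.eventually_lt continuousAt_const (lt_add_one _)).mono fun x hx => hx.le)
  refine ⟨∑ i, (|b.coord i (u x₀)| + 1) * |C i|, by positivity, ?_⟩
  filter_upwards [hc, eventually_all.2 hC] with x hx hCx w
  have h : T (u x) x w = ∑ i, b.coord i (u x) • T (b i) x w := by
    conv_lhs => rw [← b.sum_repr (u x)]
    have := map_sum (hT x w).mk' (fun i => b.repr (u x) i • b i) Finset.univ
    simpa only [IsLinearMap.mk'_apply, (hT x w).map_smul, Module.Basis.coord_apply] using this
  rw [h, Finset.sum_mul]
  refine (norm_sum_le _ _).trans (Finset.sum_le_sum fun i _ => ?_)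
  rw [norm_smul, Real.norm_eq_abs, mul_assoc]
  exact mul_le_mul (hx i) ((hCx i w).trans (by gcongr; exact le_abs_self _)) (norm_nonneg _)
    (by positivity)

/-! ### The moment of the connection of an equivariant bundle -/

section Fiber

variable {EB : Type*} [NormedAddCommGroup EB] [NormedSpace ℝ EB]
  {N : Type*} [TopologicalSpace N] [ChartedSpace EB N]
  {X : Type*} [TopologicalSpace X]
  {F : Type*} [NormedAddCommGroup F] [NormedSpace ℝ F]
  {V : X → Type*} [TopologicalSpace (TotalSpace F V)]
  [∀ x, NormedAddCommGroup (V x)] [∀ x, NormedSpace ℝ (V x)]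
  [FiberBundle F V] [VectorBundle ℝ F V]

/-- The map stays in a single fibre, which the trivialization identifies with the model by a
continuous linear isomorphism. -/
theorem mdifferentiableAt_fiber_iff (e : Trivialization F (π F V)) [MemTrivializationAtlas e]
    {x : X} (hx : x ∈ e.baseSet) {γ : N → V x} {n : N} :
    MDifferentiableAt 𝓘(ℝ, EB) 𝓘(ℝ, V x) γ n ↔
      MDifferentiableAt 𝓘(ℝ, EB) 𝓘(ℝ, F) (fun m => (e ⟨x, γ m⟩).2) n := by
  let L := e.continuousLinearEquivAt ℝ x hx
  have hL : ∀ v : V x, L v = (e ⟨x, v⟩).2 := fun v => rfl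
  constructor
  · intro h
    exact L.differentiableAt.mdifferentiableAt.comp n h
  · intro h
    have h' := L.symm.differentiableAt.mdifferentiableAt.comp n h
    refine h'.congr_of_eventuallyEq (Eventually.of_forall fun m => ?_)
    rw [Function.comp_apply, ← hL, L.symm_apply_apply]

theorem trivialization_mvfderiv_fiber (e : Trivialization F (π F V)) [MemTrivializationAtlas e]
    {x : X} (hx : x ∈ e.baseSet) {γ : N → V x} {n : N}
    (hγ : MDifferentiableAt 𝓘(ℝ, EB) 𝓘(ℝ, V x) γ n) (u : TangentSpace 𝓘(ℝ, EB) n) :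
    (e ⟨x, mvfderiv 𝓘(ℝ, EB) γ n u⟩).2 =
      mvfderiv 𝓘(ℝ, EB) (fun m => (e ⟨x, γ m⟩).2) n u := by
  let L := e.continuousLinearEquivAt ℝ x hx
  have h := (L.hasFDerivAt (x := γ n)).hasMFDerivAt.comp n hγ.hasMFDerivAt
  exact (congrArg (fun T : TangentSpace 𝓘(ℝ, EB) n →L[ℝ] F => T u) h.mfderiv).symm

end Fiber

section EquivariantBundle

variable {EM : Type*} [NormedAddCommGroup EM] [NormedSpace ℂ EM] [FiniteDimensional ℂ EM]
  {M : Type*} [TopologicalSpace M] [T2Space M] [ChartedSpace EM M] [IsManifold 𝓘(ℂ, EM) ω M]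
  {EG : Type*} [NormedAddCommGroup EG] [NormedSpace ℝ EG]
  {G : Type*} [TopologicalSpace G] [ChartedSpace EG G] [Group G] [LieGroup 𝓘(ℝ, EG) ∞ G]
  [MulAction G M] [ContMDiffSMul 𝓘(ℝ, EG) 𝓘(ℝ, EM) ∞ G M]
  {FE : Type*} [NormedAddCommGroup FE] [NormedSpace ℂ FE] [FiniteDimensional ℂ FE]
  {E : M → Type*} [TopologicalSpace (TotalSpace FE E)]
  [∀ x, NormedAddCommGroup (E x)] [∀ x, InnerProductSpace ℂ (E x)]
  [FiberBundle FE E] [VectorBundle ℂ FE E] [ContMDiffVectorBundle ω FE E 𝓘(ℂ, EM)]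
  (A : EquivariantStructure EM EG G FE E)

theorem IsSmoothHermitianBundle.hasContinuousNorm (hE : IsSmoothHermitianBundle EM FE E) :
    HasContinuousNorm EM FE E := fun U σ hU hσ => by
  have h := (hE U σ σ hU hσ hσ).continuousOn
  have h' : ContinuousOn (fun x => √(RCLike.re (inner ℂ (σ x) (σ x)))) U :=
    Real.continuous_sqrt.comp_continuousOn (RCLike.continuous_re.comp_continuousOn h)
  exact h'.congr fun x _ => norm_eq_sqrt_re_inner (𝕜 := ℂ) (σ x)

theorem exists_norm_covariantDerivative_le (hE : HasContinuousNorm EM FE E)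
    {nabla : CovariantDerivative 𝓘(ℝ, EM) FE E}
    (hnabla : CovariantDerivative.ContMDiffCovariantDerivative nabla ∞)
    {σ : Π x : M, E x} {U : Set M} (hU : IsOpen U)
    (hσ : ContMDiffOn 𝓘(ℝ, EM) (𝓘(ℝ, EM).prod 𝓘(ℝ, FE)) ∞
      (fun x => (⟨x, σ x⟩ : TotalSpace FE E)) U)
    {X : Π x : M, TangentSpace 𝓘(ℝ, EM) x}
    (hX : ContMDiff 𝓘(ℝ, EM) 𝓘(ℝ, EM).tangent ∞
      (fun x => (⟨x, X x⟩ : TangentBundle 𝓘(ℝ, EM) M))) {x₀ : M} (hx₀ : x₀ ∈ U) :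
    ∃ C : ℝ, ∀ᶠ x in 𝓝 x₀, ‖nabla σ x (X x)‖ ≤ C := by
  obtain ⟨f, -, hf⟩ := (SmoothBumpFunction.nhds_basis_tsupport (I := 𝓘(ℝ, EM)) x₀).mem_iff.1
    (hU.mem_nhds hx₀)
  have hfσ : ContMDiff 𝓘(ℝ, EM) (𝓘(ℝ, EM).prod 𝓘(ℝ, FE)) ∞
      (fun x => (⟨x, f x • σ x⟩ : TotalSpace FE E)) :=
    ContMDiffOn.smul_section_of_tsupport f.contMDiff.contMDiffOn hU hf hσ
  have h1 := hnabla.contMDiff.contMDiff (σ := fun x => f x • σ x) hfσ.contMDiffOn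
  have h2 := (ContMDiffOn.clm_bundle_apply (b := fun x => x) h1 hX.contMDiffOn)
  have h3 := (hE univ _ isOpen_univ h2).continuousAt (x := x₀) univ_mem
  refine ⟨‖nabla (fun x => f x • σ x) x₀ (X x₀)‖ + 1, ?_⟩
  filter_upwards [h3.eventually_lt continuousAt_const (lt_add_one _),
    -- The cutoff provides a global section to which smoothness of the connection is applied.
    -- Locality then needs agreement with `σ` on a neighbourhood of each nearby x, not merely at x.
    eventually_eventually_nhds.2 f.eventuallyEq_one, hU.mem_nhds hx₀] with x hx hfx hxU
  have heq : nabla σ x = nabla (fun x => f x • σ x) x :=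
    nabla.isCovariantDerivativeOnUniv.congr_of_eventuallyEq
      ((hσ.contMDiffAt (hU.mem_nhds hxU)).mdifferentiableAt (by simp))
      (hfσ.mdifferentiableAt (by simp)) univ_mem (hfx.mono fun y hy => by simp [hy])
  rw [heq]
  exact hx.le

namespace EquivariantStructure

/-- In the total space the transport along g⁻¹ • g • x = x disappears, so smoothness of the lifted
action can be used. -/
theorem mk_pullback (g : G) (x : M) (e : E (g • x)) :
    (⟨x, A.pullback g x e⟩ : TotalSpace FE E) = ⟨g⁻¹ • g • x, A.map g⁻¹ (g • x) e⟩ := by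
  have h : ∀ (y : M) (hy : y = x) (e : E y), (⟨x, hy ▸ e⟩ : TotalSpace FE E) = ⟨y, e⟩ :=
    fun y hy e => by subst hy; rfl
  exact h _ _ _

theorem pullback_one (σ : Π x : M, E x) (x : M) : A.pullback (1 : G) x (σ ((1 : G) • x)) = σ x := by
  have h1 : ∀ (g : G), g = 1 → ∀ (y : M) (e : E y),
      (⟨g • y, A.map g y e⟩ : TotalSpace FE E) = ⟨y, e⟩ := fun g hg y e => by
    subst hg; exact A.map_one y e
  have h2 : (⟨x, A.pullback (1 : G) x (σ ((1 : G) • x))⟩ : TotalSpace FE E) = ⟨x, σ x⟩ := by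
    rw [A.mk_pullback, h1 _ inv_one]
    exact congrArg (fun y : M => (⟨y, σ y⟩ : TotalSpace FE E)) (one_smul G x)
  exact eq_of_heq (TotalSpace.mk.inj h2).2

theorem pullback_add (g : G) (x : M) (e e' : E (g • x)) :
    A.pullback g x (e + e') = A.pullback g x e + A.pullback g x e' := by
  have h : ∀ (y : M) (hy : y = x) (e e' : E y), (hy ▸ (e + e') : E x) = hy ▸ e + hy ▸ e' :=
    fun y hy e e' => by subst hy; rfl
  unfold pullback
  rw [map_add, h]

theorem pullback_smul (g : G) (x : M) (c : ℝ) (e : E (g • x)) :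
    A.pullback g x (c • e) = c • A.pullback g x e := by
  have h : ∀ (y : M) (hy : y = x) (e : E y), (hy ▸ (c • e) : E x) = c • hy ▸ e :=
    fun y hy e => by subst hy; rfl
  unfold pullback
  rw [ContinuousLinearMap.map_smul_of_tower, h]

theorem contMDiffAt_mk_pullback {σ : Π x : M, E x} {x : M}
    (hσ : ContMDiffAt 𝓘(ℝ, EM) (𝓘(ℝ, EM).prod 𝓘(ℝ, FE)) ∞
      (fun x => (⟨x, σ x⟩ : TotalSpace FE E)) x) :
    ContMDiffAt (𝓘(ℝ, EG).prod 𝓘(ℝ, EM)) (𝓘(ℝ, EM).prod 𝓘(ℝ, FE)) ∞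
      (fun p : G × M => (⟨p.2, A.pullback p.1 p.2 (σ (p.1 • p.2))⟩ : TotalSpace FE E)) (1, x) := by
  have hsmul : ContMDiff (𝓘(ℝ, EG).prod 𝓘(ℝ, EM)) 𝓘(ℝ, EM) ∞ (fun p : G × M => p.1 • p.2) :=
    ContMDiffSMul.contMDiff_smul
  have h1 : ContMDiffAt (𝓘(ℝ, EG).prod 𝓘(ℝ, EM)) 𝓘(ℝ, EG) ∞ (fun p : G × M => p.1⁻¹) (1, x) :=
    ((contMDiff_inv 𝓘(ℝ, EG) ∞).comp contMDiff_fst).contMDiffAt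
  have h2 : ContMDiffAt (𝓘(ℝ, EG).prod 𝓘(ℝ, EM)) (𝓘(ℝ, EM).prod 𝓘(ℝ, FE)) ∞
      (fun p : G × M => (⟨p.1 • p.2, σ (p.1 • p.2)⟩ : TotalSpace FE E)) (1, x) :=
    ContMDiffAt.comp_of_eq (g := fun x => (⟨x, σ x⟩ : TotalSpace FE E)) hσ hsmul.contMDiffAt
      (one_smul G x)
  refine (A.smooth.contMDiffAt.comp (1, x) (h1.prodMk h2)).congr_of_eventuallyEq
    (Eventually.of_forall fun p => ?_)
  exact A.mk_pullback _ _ _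

theorem mdifferentiableAt_pullback {σ : Π x : M, E x} {x : M}
    (hσ : MDifferentiableAt 𝓘(ℝ, EM) (𝓘(ℝ, EM).prod 𝓘(ℝ, FE))
      (fun x => (⟨x, σ x⟩ : TotalSpace FE E)) x) :
    MDifferentiableAt 𝓘(ℝ, EG) 𝓘(ℝ, E x) (fun g : G => A.pullback g x (σ (g • x))) 1 := by
  have hsmul : ContMDiff (𝓘(ℝ, EG).prod 𝓘(ℝ, EM)) 𝓘(ℝ, EM) ∞ (fun p : G × M => p.1 • p.2) :=
    ContMDiffSMul.contMDiff_smul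
  have horb : MDifferentiableAt 𝓘(ℝ, EG) 𝓘(ℝ, EM) (fun g : G => g • x) 1 :=
    ((hsmul.comp (contMDiff_id.prodMk contMDiff_const)).mdifferentiable (by simp)) 1
  have h1 : MDifferentiableAt 𝓘(ℝ, EG) 𝓘(ℝ, EG) (fun g : G => g⁻¹) 1 :=
    (contMDiff_inv 𝓘(ℝ, EG) ∞).mdifferentiable (by simp) 1
  have h2 : MDifferentiableAt 𝓘(ℝ, EG) (𝓘(ℝ, EM).prod 𝓘(ℝ, FE))
      (fun g : G => (⟨g • x, σ (g • x)⟩ : TotalSpace FE E)) 1 :=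
    MDifferentiableAt.comp_of_eq (g := fun x => (⟨x, σ x⟩ : TotalSpace FE E)) 1 hσ horb
      (one_smul G x)
  have h3 : MDifferentiableAt 𝓘(ℝ, EG) (𝓘(ℝ, EM).prod 𝓘(ℝ, FE))
      (fun g : G => (⟨x, A.pullback g x (σ (g • x))⟩ : TotalSpace FE E)) 1 := by
    have h := (A.smooth.mdifferentiable (by simp) _).comp 1 (h1.prodMk h2)
    exact h.congr_of_eventuallyEq (Eventually.of_forall fun g => A.mk_pullback _ _ _)
  rw [mdifferentiableAt_fiber_iff (trivializationAt FE E x)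
    (FiberBundle.mem_baseSet_trivializationAt' x)]
  exact ((mdifferentiableAt_totalSpace 𝓘(ℝ, EM) _).1 h3).2

theorem lieDeriv_add {σ τ : Π x : M, E x} {x : M}
    (hσ : MDifferentiableAt 𝓘(ℝ, EM) (𝓘(ℝ, EM).prod 𝓘(ℝ, FE))
      (fun x => (⟨x, σ x⟩ : TotalSpace FE E)) x)
    (hτ : MDifferentiableAt 𝓘(ℝ, EM) (𝓘(ℝ, EM).prod 𝓘(ℝ, FE))
      (fun x => (⟨x, τ x⟩ : TotalSpace FE E)) x) (u : LieAlg EG G) :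
    A.lieDeriv u (σ + τ) x = A.lieDeriv u σ x + A.lieDeriv u τ x := by
  have h : (fun g : G => A.pullback g x ((σ + τ) (g • x))) =
      fun g => A.pullback g x (σ (g • x)) + A.pullback g x (τ (g • x)) :=
    funext fun g => A.pullback_add _ _ _ _
  unfold lieDeriv
  rw [h, mvfderiv_fun_add (A.mdifferentiableAt_pullback hσ) (A.mdifferentiableAt_pullback hτ)]
  rfl

/-- Pulling back fσ gives f(gx) times the pullback of σ, and g ↦ f(gx) has derivative df(u_M) at 1
along u. -/
theorem lieDeriv_smul {f : M → ℝ} {σ : Π x : M, E x} {x : M}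
    (hf : MDifferentiableAt 𝓘(ℝ, EM) 𝓘(ℝ, ℝ) f x)
    (hσ : MDifferentiableAt 𝓘(ℝ, EM) (𝓘(ℝ, EM).prod 𝓘(ℝ, FE))
      (fun x => (⟨x, σ x⟩ : TotalSpace FE E)) x) (u : LieAlg EG G) :
    A.lieDeriv u (f • σ) x = f x • A.lieDeriv u σ x +
      mvfderiv 𝓘(ℝ, EM) f x (fundamentalField u x) • σ x := by
  have hsmul : ContMDiff (𝓘(ℝ, EG).prod 𝓘(ℝ, EM)) 𝓘(ℝ, EM) ∞ (fun p : G × M => p.1 • p.2) :=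
    ContMDiffSMul.contMDiff_smul
  have horb : MDifferentiableAt 𝓘(ℝ, EG) 𝓘(ℝ, EM) (fun g : G => g • x) 1 :=
    ((hsmul.comp (contMDiff_id.prodMk contMDiff_const)).mdifferentiable (by simp)) 1
  have h : (fun g : G => A.pullback g x ((f • σ) (g • x))) =
      fun g => f (g • x) • A.pullback g x (σ (g • x)) :=
    funext fun g => A.pullback_smul _ _ _ _
  have hfo : MDifferentiableAt 𝓘(ℝ, EG) 𝓘(ℝ, ℝ) (fun g : G => f (g • x)) 1 :=
    MDifferentiableAt.comp_of_eq (g := f) 1 hf horb (one_smul G x)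
  have hd : mvfderiv 𝓘(ℝ, EG) (fun g : G => f (g • x)) 1 u =
      mvfderiv 𝓘(ℝ, EM) f x (fundamentalField u x) :=
    mvfderiv_comp_apply_of_eq (f := fun g : G => g • x) (g := f) 1 hf horb (one_smul G x) u
  unfold lieDeriv
  rw [h, mvfderiv_fun_smul hfo (A.mdifferentiableAt_pullback hσ)]
  have h1 := A.pullback_one σ x
  have h2 : f ((1 : G) • x) = f x := by rw [one_smul]
  rw [h1, h2, ← hd]
  rfl

end EquivariantStructure

end EquivariantBundle

section BundleMoment

variable {EM : Type*} [NormedAddCommGroup EM] [NormedSpace ℂ EM] [FiniteDimensional ℂ EM]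
  {M : Type*} [TopologicalSpace M] [T2Space M] [ChartedSpace EM M] [IsManifold 𝓘(ℂ, EM) ω M]
  {EG : Type*} [NormedAddCommGroup EG] [NormedSpace ℝ EG]
  {G : Type*} [TopologicalSpace G] [ChartedSpace EG G] [Group G] [LieGroup 𝓘(ℝ, EG) ∞ G]
  [MulAction G M] [ContMDiffSMul 𝓘(ℝ, EG) 𝓘(ℝ, EM) ∞ G M]
  {FE : Type*} [NormedAddCommGroup FE] [NormedSpace ℂ FE] [FiniteDimensional ℂ FE]
  {E : M → Type*} [TopologicalSpace (TotalSpace FE E)]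
  [∀ x, NormedAddCommGroup (E x)] [∀ x, InnerProductSpace ℂ (E x)]
  [FiberBundle FE E] [VectorBundle ℂ FE E] [ContMDiffVectorBundle ω FE E 𝓘(ℂ, EM)]
  (A : EquivariantStructure EM EG G FE E) (nabla : CovariantDerivative 𝓘(ℝ, EM) FE E)

/-- ∇_{u_M} and L_u obey Leibniz rules with the same term df(u_M)σ, which cancels in the difference.
-/
theorem tensorialAt_moment (u : LieAlg EG G) (x : M) :
    TensorialAt 𝓘(ℝ, EM) FE
      (fun σ : Π x : M, E x => nabla σ x (fundamentalField u x) - A.lieDeriv u σ x) x where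
  smul {f σ} hf hσ := by
    rw [nabla.isCovariantDerivativeOnUniv.leibniz hσ hf, A.lieDeriv_smul hf hσ]
    simp only [add_apply, smul_apply,
      ContinuousLinearMap.smulRight_apply, smul_sub]
    abel
  add {σ τ} hσ hτ := by
    rw [nabla.isCovariantDerivativeOnUniv.add hσ hτ, A.lieDeriv_add hσ hτ]
    simp only [add_apply]
    abel

theorem isLinearMap_bundleMoment (x : M) (e : E x) :
    IsLinearMap ℝ (fun u : LieAlg EG G => bundleMoment A nabla u x e) :=
  let D : EG →L[ℝ] E x := mvfderiv 𝓘(ℝ, EG)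
    (fun g : G => A.pullback g x (FiberBundle.extend FE e (g • x))) 1
  have hD : ∀ u, A.lieDeriv u (FiberBundle.extend FE e) x = D u := fun _ => rfl
  { map_add := fun u u' => by
      have h : D (u + u') = D u + D u' := D.map_add u u'
      simp only [bundleMoment, hD, fundamentalField_add, Pi.add_apply, map_add]
      rw [h]
      abel
    map_smul := fun c u => by
      have h : D (c • u) = c • D u := D.map_smul c u
      simp only [bundleMoment, hD, fundamentalField_smul, Pi.smul_apply, map_smul]
      rw [h, smul_sub] }

/-- Tensoriality replaces the chosen extension, which varies uncontrollably with x, by fixed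
sections such as a local frame. -/
theorem bundleMoment_sum (u : LieAlg EG G) {x : M} {ι : Type*} [Fintype ι] (c : ι → ℝ)
    {s : ι → Π x : M, E x} (hs : ∀ i, MDifferentiableAt 𝓘(ℝ, EM) (𝓘(ℝ, EM).prod 𝓘(ℝ, FE))
      (fun x => (⟨x, s i x⟩ : TotalSpace FE E)) x) :
    bundleMoment A nabla u x (∑ i, c i • s i x) =
      ∑ i, c i • (nabla (s i) x (fundamentalField u x) - A.lieDeriv u (s i) x) := by
  have hT := tensorialAt_moment A nabla u x
  change TensorialAt.mkHom _ x hT (∑ i, c i • s i x) = _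
  rw [map_sum]
  refine Finset.sum_congr rfl fun i _ => ?_
  rw [map_smul, TensorialAt.mkHom_apply hT (hs i)]

/-- Read in the trivialization at x₀, the Lie derivative at x is the derivative at (1, x) in
direction (u, 0) of one smooth function of (g, x). -/
theorem EquivariantStructure.continuousAt_trivialization_lieDeriv {σ : Π x : M, E x} {x₀ : M}
    (hσ : ContMDiffAt 𝓘(ℝ, EM) (𝓘(ℝ, EM).prod 𝓘(ℝ, FE)) ∞
      (fun x => (⟨x, σ x⟩ : TotalSpace FE E)) x₀) (u : LieAlg EG G) :
    ContinuousAt (fun x => (trivializationAt FE E x₀ ⟨x, A.lieDeriv u σ x⟩).2) x₀ := by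
  set e := trivializationAt FE E x₀ with he
  have hx₀ : x₀ ∈ e.baseSet := FiberBundle.mem_baseSet_trivializationAt' x₀
  set F : G × M → FE := fun p => (e ⟨p.2, A.pullback p.1 p.2 (σ (p.1 • p.2))⟩).2 with hF
  have hF1 : ContMDiffAt (𝓘(ℝ, EG).prod 𝓘(ℝ, EM)) 𝓘(ℝ, FE) 1 F (1, x₀) :=
    ((contMDiffAt_totalSpace.1 (A.contMDiffAt_mk_pullback hσ)).2).of_le ENat.LEInfty.out
  have hG1 : IsManifold 𝓘(ℝ, EG) (∞ + 1) G := (inferInstance : IsManifold 𝓘(ℝ, EG) ∞ G)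
  have hM1 : IsManifold 𝓘(ℝ, EM) (∞ + 1) M := isManifold_real
  have hγ : Continuous (fun x : M => (equivTangentBundleProd 𝓘(ℝ, EG) G 𝓘(ℝ, EM) M).symm
      ((⟨1, u⟩ : TangentBundle 𝓘(ℝ, EG) G), (⟨x, 0⟩ : TangentBundle 𝓘(ℝ, EM) M))) := by
    have h1 : ContMDiff 𝓘(ℝ, EM) (𝓘(ℝ, EG).tangent.prod 𝓘(ℝ, EM).tangent) ∞
        (fun x : M => ((⟨1, u⟩ : TangentBundle 𝓘(ℝ, EG) G),
          (⟨x, 0⟩ : TangentBundle 𝓘(ℝ, EM) M))) :=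
      contMDiff_const.prodMk (contMDiff_zeroSection ℝ (TangentSpace 𝓘(ℝ, EM)))
    exact ((contMDiff_equivTangentBundleProd_symm (n := ∞)).comp h1).continuous
  have hc := continuousAt_mvfderiv_comp (γ := fun x : M =>
    (equivTangentBundleProd 𝓘(ℝ, EG) G 𝓘(ℝ, EM) M).symm
      ((⟨1, u⟩ : TangentBundle 𝓘(ℝ, EG) G), (⟨x, 0⟩ : TangentBundle 𝓘(ℝ, EM) M)))
    (y := x₀) (f := F) hF1 hγ.continuousAt
  refine hc.congr ?_
  have hσx : ∀ᶠ x in 𝓝 x₀, ContMDiffAt 𝓘(ℝ, EM) (𝓘(ℝ, EM).prod 𝓘(ℝ, FE)) 1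
      (fun x => (⟨x, σ x⟩ : TotalSpace FE E)) x :=
    (contMDiffAt_iff_contMDiffAt_nhds (by simp)).1 (hσ.of_le ENat.LEInfty.out)
  have hFx : ∀ᶠ x in 𝓝 x₀, ContMDiffAt (𝓘(ℝ, EG).prod 𝓘(ℝ, EM)) 𝓘(ℝ, FE) 1 F (1, x) :=
    ((Continuous.prodMk_right (1 : G)).tendsto x₀).eventually
      ((contMDiffAt_iff_contMDiffAt_nhds (by simp)).1 hF1)
  filter_upwards [e.open_baseSet.mem_nhds hx₀, hσx, hFx] with x hx hσ' hF'
  have h1 := trivialization_mvfderiv_fiber e hx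
    (A.mdifferentiableAt_pullback (hσ'.mdifferentiableAt (by simp))) u
  refine Eq.trans ?_ h1.symm
  have h2 := mfderiv_prod_eq_add_apply (p := ((1, x) : G × M)) (v := ((u, 0) : EG × EM))
    (hF'.mdifferentiableAt (by simp))
  refine h2.trans ?_
  exact (congrArg _ (ContinuousLinearMap.map_zero _)).trans (add_zero _)

/-- On a local frame the two parts of the moment are bounded separately, although neither is
tensorial: the covariant derivative through its norm, the Lie derivative through its coordinates. -/
theorem exists_bundleMoment_le (hE : HasContinuousNorm EM FE E)
    (hnabla : CovariantDerivative.ContMDiffCovariantDerivative nabla ∞) (u : LieAlg EG G)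
    (x₀ : M) : ∃ C : ℝ, ∀ᶠ x in 𝓝 x₀, ∀ e : E x, ‖bundleMoment A nabla u x e‖ ≤ C * ‖e‖ := by
  let b := Module.finBasis ℝ FE
  set t := trivializationAt FE E x₀ with ht
  have hx₀ : x₀ ∈ t.baseSet := FiberBundle.mem_baseSet_trivializationAt' x₀
  have hs : ∀ i, ContMDiffOn 𝓘(ℝ, EM) (𝓘(ℝ, EM).prod 𝓘(ℝ, FE)) ∞
      (fun x => (⟨x, t.localFrame b i x⟩ : TotalSpace FE E)) t.baseSet :=
    fun i => t.contMDiffOn_localFrame_baseSet ∞ b i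
  obtain ⟨C, hC, hCx⟩ := hE.exists_frame_bounds b x₀
  choose K hK using fun i => exists_norm_covariantDerivative_le hE hnabla t.open_baseSet (hs i)
    (contMDiff_fundamentalField (M := M) u) hx₀
  set c : Fin (Module.finrank ℝ FE) → Fin (Module.finrank ℝ FE) → M → ℝ := fun i j x =>
    b.coord j (t ⟨x, A.lieDeriv u (t.localFrame b i) x⟩).2 with hc
  have hcx : ∀ᶠ x in 𝓝 x₀, ∀ i j, |c i j x| ≤ |c i j x₀| + 1 := by
    refine eventually_all.2 fun i => eventually_all.2 fun j => ?_
    have h := A.continuousAt_trivialization_lieDeriv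
      ((hs i).contMDiffAt (t.open_baseSet.mem_nhds hx₀)) u
    have h' : ContinuousAt (fun x => |c i j x|) x₀ :=
      ((LinearMap.toContinuousLinearMap (b.coord j)).continuous.continuousAt.comp h).abs
    exact (h'.eventually_lt continuousAt_const (lt_add_one _)).mono fun x hx => hx.le
  refine ⟨∑ i, C * (|K i| + ∑ j, (|c i j x₀| + 1) * C), ?_⟩
  filter_upwards [hCx, hcx, eventually_all.2 hK, t.open_baseSet.mem_nhds hx₀]
    with x h1 h2 h3 hx e
  have hl : ∀ i, ‖A.lieDeriv u (t.localFrame b i) x‖ ≤ ∑ j, (|c i j x₀| + 1) * C := fun i => by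
    rw [← sum_repr_smul_localFrame t b hx (A.lieDeriv u (t.localFrame b i) x)]
    refine (norm_sum_le _ _).trans (Finset.sum_le_sum fun j _ => ?_)
    rw [norm_smul]
    exact mul_le_mul (h2 i j) (h1.1 j) (norm_nonneg _) (by positivity)
  rw [← sum_repr_smul_localFrame t b hx e, bundleMoment_sum A nabla u _ fun i =>
    ((hs i).contMDiffAt (t.open_baseSet.mem_nhds hx)).mdifferentiableAt (by simp),
    sum_repr_smul_localFrame t b hx e, Finset.sum_mul]
  refine (norm_sum_le _ _).trans (Finset.sum_le_sum fun i _ => ?_)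
  rw [norm_smul]
  calc _ ≤ (C * ‖e‖) * (|K i| + ∑ j, (|c i j x₀| + 1) * C) := by
        refine mul_le_mul (h1.2 e i) ((norm_sub_le _ _).trans (add_le_add
          ((h3 i).trans (le_abs_self _)) (hl i))) (norm_nonneg _) (by positivity)
    _ = _ := by ring

end BundleMoment

/-! ### Local bounds for `ν` -/

section SpinorMoment

variable {EM : Type*} [NormedAddCommGroup EM] [NormedSpace ℂ EM] [FiniteDimensional ℂ EM]
  {M : Type*} [TopologicalSpace M] [ChartedSpace EM M] [IsManifold 𝓘(ℂ, EM) ω M]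
  [RiemannianBundle (fun x : M => TangentSpace 𝓘(ℝ, EM) x)]
  [IsContMDiffRiemannianBundle 𝓘(ℝ, EM) ∞ EM (fun x : M => TangentSpace 𝓘(ℝ, EM) x)]
  {EG : Type*} [NormedAddCommGroup EG] [NormedSpace ℝ EG] [FiniteDimensional ℝ EG]
  {G : Type*} [TopologicalSpace G] [ChartedSpace EG G] [Group G] [MulAction G M]
  {FE : Type*} [NormedAddCommGroup FE] [NormedSpace ℂ FE]
  {E : M → Type*} [TopologicalSpace (TotalSpace FE E)]
  [∀ x, NormedAddCommGroup (E x)] [∀ x, InnerProductSpace ℂ (E x)]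
  [FiberBundle FE E]
  (A : EquivariantStructure EM EG G FE E) (nabla : CovariantDerivative 𝓘(ℝ, EM) FE E)

theorem spinorMomentNorm_nonneg (u : LieAlg EG G) (x : M) :
    0 ≤ spinorMomentNorm A nabla u x :=
  Real.sInf_nonneg fun _ h => h.1

theorem norm_apply_basis_le_formNorm (x : M)
    (α : Π p : Fin (Module.finrank ℂ EM + 1), (Fin p → TangentSpace 𝓘(ℝ, EM) x) → E x)
    (p : Fin (Module.finrank ℂ EM + 1))
    (i : Fin p → Fin (Module.finrank ℝ (TangentSpace 𝓘(ℝ, EM) x))) :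
    ‖α p (fun k => stdOrthonormalBasis ℝ (TangentSpace 𝓘(ℝ, EM) x) (i k))‖ ≤
      √(Nat.factorial p : ℝ) * formNorm x α := by
  rw [formNorm, ← Real.sqrt_mul (Nat.cast_nonneg _)]
  refine Real.le_sqrt_of_sq_le ?_
  have hp : (0 : ℝ) < Nat.factorial p := Nat.cast_pos.2 (Nat.factorial_pos _)
  rw [← div_le_iff₀' hp]
  refine le_trans ?_ (Finset.single_le_sum (f := fun p : Fin (Module.finrank ℂ EM + 1) =>
    (∑ i : Fin p → Fin (Module.finrank ℝ (TangentSpace 𝓘(ℝ, EM) x)),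
      ‖α p (fun k => stdOrthonormalBasis ℝ (TangentSpace 𝓘(ℝ, EM) x) (i k))‖ ^ 2)
        / (Nat.factorial p : ℝ)) (fun _ _ => by positivity) (Finset.mem_univ p))
  gcongr
  exact Finset.single_le_sum (f := fun i : Fin p → Fin (Module.finrank ℝ (TangentSpace 𝓘(ℝ, EM) x))
    => ‖α p (fun k => stdOrthonormalBasis ℝ (TangentSpace 𝓘(ℝ, EM) x) (i k))‖ ^ 2)
    (fun _ _ => by positivity) (Finset.mem_univ i)

theorem formNorm_nonneg (x : M)
    (α : Π p : Fin (Module.finrank ℂ EM + 1), (Fin p → TangentSpace 𝓘(ℝ, EM) x) → E x) :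
    0 ≤ formNorm x α := Real.sqrt_nonneg _

/-- Expanding `w` in the orthonormal basis gives dim_ℝ M terms, each with coefficient at most ‖w‖.
-/
theorem norm_apply_update_basis_le (x : M) (α : SpinorFiber EM E x)
    (p : Fin (Module.finrank ℂ EM + 1))
    (i : Fin p → Fin (Module.finrank ℝ (TangentSpace 𝓘(ℝ, EM) x))) (j : Fin p)
    (w : TangentSpace 𝓘(ℝ, EM) x) :
    ‖(α p).1 (Function.update
        (fun k => stdOrthonormalBasis ℝ (TangentSpace 𝓘(ℝ, EM) x) (i k)) j w)‖ ≤
      Module.finrank ℝ EM * (‖w‖ * (√(Nat.factorial p : ℝ) *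
        formNorm x (fun p w => (α p).1 w))) := by
  set b := stdOrthonormalBasis ℝ (TangentSpace 𝓘(ℝ, EM) x) with hb
  have hw : w = ∑ k, b.repr w k • b k := (b.sum_repr w).symm
  have hsum : (α p).1 (Function.update (fun k => b (i k)) j w) =
      ∑ k, b.repr w k • (α p).1 (fun l => b (Function.update i j k l)) := by
    conv_lhs => rw [hw]
    have h := (α p).1.toMultilinearMap.map_update_sum Finset.univ j
      (fun k => b.repr w k • b k) (fun k => b (i k))
    refine h.trans (Finset.sum_congr rfl fun k _ => ?_)
    have h' := (α p).1.toMultilinearMap.map_update_smul (fun k => b (i k)) j (b.repr w k) (b k)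
    refine h'.trans (congrArg _ (congrArg _ ?_))
    ext1 l
    rcases eq_or_ne l j with rfl | hl
    · simp
    · simp [hl]
  rw [hsum]
  refine (norm_sum_le _ _).trans ((Finset.sum_le_card_nsmul _ _ (‖w‖ * (√(Nat.factorial p : ℝ) *
        formNorm x (fun p w => (α p).1 w))) fun k _ => ?_).trans_eq ?_)
  · rw [norm_smul]
    refine mul_le_mul ?_ (norm_apply_basis_le_formNorm x (fun p w => (α p).1 w) p _)
      (norm_nonneg _) (norm_nonneg _)
    rw [b.repr_apply_apply]
    exact (norm_inner_le_norm _ _).trans_eq (by rw [b.norm_eq_one, one_mul])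
  · rw [Finset.card_univ, Fintype.card_fin, nsmul_eq_mul]
    rfl

/-- With n = dim_ℝ M, there are nᵖ basis tuples in degree p. On each the Leibniz formula costs C₁
plus p slots at n·C₂, and the factor p! from bounding a component by the norm cancels the 1/p! in
`formNorm`. The bound is crude, but depends only on n, C₁ and C₂. -/
theorem spinorMomentNorm_le {u : LieAlg EG G} {x : M} {C₁ C₂ : ℝ} (hC₁ : 0 ≤ C₁)
    (h₁ : ∀ e : E x, ‖bundleMoment A nabla u x e‖ ≤ C₁ * ‖e‖)
    (h₂ : ∀ w : TangentSpace 𝓘(ℝ, EM) x, ‖tangentMoment u x w‖ ≤ C₂ * ‖w‖) :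
    spinorMomentNorm A nabla u x ≤ √(∑ p : Fin (Module.finrank ℂ EM + 1),
      (Module.finrank ℝ EM : ℝ) ^ (p : ℕ) * (C₁ + p * (Module.finrank ℝ EM * C₂)) ^ 2) := by
  refine csInf_le ⟨0, fun _ h => h.1⟩ ⟨Real.sqrt_nonneg _, fun α => ?_⟩
  set N := formNorm x (fun p w => (α p).1 w) with hN
  have hN0 : 0 ≤ N := formNorm_nonneg _ _
  set b := stdOrthonormalBasis ℝ (TangentSpace 𝓘(ℝ, EM) x) with hb
  have hp : ∀ (p : Fin (Module.finrank ℂ EM + 1))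
      (i : Fin p → Fin (Module.finrank ℝ (TangentSpace 𝓘(ℝ, EM) x))),
      ‖spinorMoment A nabla u x α p (fun k => b (i k))‖ ≤
        (C₁ + p * (Module.finrank ℝ EM * C₂)) * (√(Nat.factorial p : ℝ) * N) := fun p i => by
    refine (norm_sub_le _ _).trans ?_
    rw [add_mul]
    refine add_le_add ?_ ?_
    · refine (h₁ _).trans ?_
      gcongr
      exact norm_apply_basis_le_formNorm x (fun p w => (α p).1 w) p i
    · refine (norm_sum_le _ _).trans ((Finset.sum_le_card_nsmul _ _
        (Module.finrank ℝ EM * (C₂ * (√(Nat.factorial p : ℝ) * N))) fun j _ => ?_).trans_eq ?_)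
      · refine (norm_apply_update_basis_le x α p i j _).trans ?_
        gcongr
        exact (h₂ _).trans_eq (by rw [b.norm_eq_one, mul_one])
      · rw [Finset.card_univ, Fintype.card_fin, nsmul_eq_mul]
        ring
  rw [← Real.sqrt_sq hN0, ← Real.sqrt_mul (by positivity), formNorm]
  refine Real.sqrt_le_sqrt ?_
  rw [Finset.sum_mul]
  refine Finset.sum_le_sum fun p _ => ?_
  have hfac : (0 : ℝ) < Nat.factorial p := Nat.cast_pos.2 (Nat.factorial_pos _)
  rw [div_le_iff₀ hfac]
  refine (Finset.sum_le_card_nsmul _ _ (((C₁ + p * (Module.finrank ℝ EM * C₂)) *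
    (√(Nat.factorial p : ℝ) * N)) ^ 2) fun i _ => ?_).trans_eq ?_
  · exact pow_le_pow_left₀ (norm_nonneg _) (hp p i) 2
  · rw [Finset.card_univ, Fintype.card_fun, Fintype.card_fin, Fintype.card_fin, nsmul_eq_mul,
      mul_pow, mul_pow, Real.sq_sqrt hfac.le, Nat.cast_pow]
    change (Module.finrank ℝ EM : ℝ) ^ (p : ℕ) * _ = _
    ring

end SpinorMoment

theorem norm_smul_strongDual {V : Type*} [NormedAddCommGroup V] [NormedSpace ℝ V] (c : ℝ)
    (L : V →L[ℝ] ℝ) : ‖c • L‖ = |c| * ‖L‖ :=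
  norm_smul c L

/-! ### Local boundedness of (ν + 1)/|v|² and the norm of df -/

section LocalBound

variable {EM : Type*} [NormedAddCommGroup EM] [NormedSpace ℂ EM] [FiniteDimensional ℂ EM]
  {M : Type*} [TopologicalSpace M] [T2Space M] [ChartedSpace EM M] [IsManifold 𝓘(ℂ, EM) ω M]
  [RiemannianBundle (fun x : M => TangentSpace 𝓘(ℝ, EM) x)]
  [IsContMDiffRiemannianBundle 𝓘(ℝ, EM) ∞ EM (fun x : M => TangentSpace 𝓘(ℝ, EM) x)]
  {EG : Type*} [NormedAddCommGroup EG] [NormedSpace ℝ EG] [FiniteDimensional ℝ EG]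
  {G : Type*} [TopologicalSpace G] [ChartedSpace EG G] [Group G] [LieGroup 𝓘(ℝ, EG) ∞ G]
  [MulAction G M] [ContMDiffSMul 𝓘(ℝ, EG) 𝓘(ℝ, EM) ∞ G M]
  {B : InvariantScalarProduct EG G} {μ : M → LieCoalg EG G} {U : Set M}
  {FE : Type*} [NormedAddCommGroup FE] [NormedSpace ℂ FE] [FiniteDimensional ℂ FE]
  {E : M → Type*} [TopologicalSpace (TotalSpace FE E)]
  [∀ x, NormedAddCommGroup (E x)] [∀ x, InnerProductSpace ℂ (E x)]
  [FiberBundle FE E] [VectorBundle ℂ FE E] [ContMDiffVectorBundle ω FE E 𝓘(ℂ, EM)]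
  (A : EquivariantStructure EM EG G FE E) {nabla : CovariantDerivative 𝓘(ℝ, EM) FE E}

theorem nu_nonneg (x : M) : 0 ≤ nu B μ A nabla x := by
  have := spinorMomentNorm_nonneg A nabla (B.psi (μ x)) x
  unfold nu
  positivity

theorem IsMomentMapOn.exists_spinorMomentNorm_le (hμ : IsMomentMapOn (EM := EM) U μ)
    (hU : IsOpen U) (hE : HasContinuousNorm EM FE E)
    (hnabla : CovariantDerivative.ContMDiffCovariantDerivative nabla ∞) {x₀ : M} (hx₀ : x₀ ∈ U) :
    ∃ C : ℝ, ∀ᶠ x in 𝓝 x₀, spinorMomentNorm A nabla (B.psi (μ x)) x ≤ C := by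
  have hu : ContinuousAt (fun x => B.psi (μ x)) x₀ :=
    B.psiL.continuous.continuousAt.comp (hμ.mdifferentiableAt hU hx₀).continuousAt
  obtain ⟨C₁, hC₁, h₁⟩ := exists_bound_of_linear_family (isLinearMap_bundleMoment A nabla)
    (fun u => exists_bundleMoment_le A nabla hE hnabla u x₀) hu
  obtain ⟨C₂, -, h₂⟩ := exists_bound_of_linear_family
    (V := fun x : M => TangentSpace 𝓘(ℝ, EM) x) isLinearMap_tangentMoment
    (fun u => exists_tangentMoment_le u x₀) hu
  exact ⟨_, (h₁.and h₂).mono fun x hx => spinorMomentNorm_le A nabla hC₁ hx.1 hx.2⟩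

theorem IsMomentMapOn.exists_nu_div_le (hμ : IsMomentMapOn (EM := EM) U μ)
    (hU : IsOpen U) (hE : HasContinuousNorm EM FE E)
    (hnabla : CovariantDerivative.ContMDiffCovariantDerivative nabla ∞) {x₀ : M} (hx₀ : x₀ ∈ U)
    (hv : tamingField (EM := EM) B μ x₀ ≠ 0) :
    ∃ C : ℝ, ∀ᶠ x in 𝓝 x₀,
      (nu B μ A nabla x + 1) / ‖tamingField (EM := EM) B μ x‖ ^ 2 ≤ C := by
  have hvs : ContMDiffAt 𝓘(ℝ, EM) 𝓘(ℝ, EM).tangent ∞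
      (fun x : M => (⟨x, tamingField B μ x⟩ : TangentBundle 𝓘(ℝ, EM) M)) x₀ :=
    (hμ.contMDiffOn_tamingField hU).contMDiffAt (hU.mem_nhds hx₀)
  have hvc : ContinuousAt (fun x => ‖tamingField (EM := EM) B μ x‖) x₀ :=
    continuousAt_norm hvs.continuousAt
  have hμc : ContinuousAt (fun x => √(B.form (μ x) (μ x))) x₀ := by
    have h := (B.formL.continuous.clm_apply continuous_id).continuousAt.comp
      (hμ.mdifferentiableAt hU hx₀).continuousAt
    exact Real.continuous_sqrt.continuousAt.comp h
  have hvs2 : ContMDiffAt 𝓘(ℝ, EM) 𝓘(ℝ, EM).tangent 2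
      (fun x : M => (⟨x, tamingField B μ x⟩ : TangentBundle 𝓘(ℝ, EM) M)) x₀ :=
    hvs.of_le ENat.LEInfty.out
  obtain ⟨C₁, h₁⟩ := exists_norm_leviCivita_le hvs2
  obtain ⟨C₂, h₂⟩ := hμ.exists_spinorMomentNorm_le (B := B) A hU hE hnabla hx₀
  have h₃ := hμc.eventually_lt continuousAt_const (lt_add_one _)
  have h₄ := hvc.eventually_lt continuousAt_const (lt_add_one _)
  -- Continuity keeps |v| above half its nonzero value at x₀, which controls the denominator.
  have h₅ := continuousAt_const.eventually_lt hvc (half_lt_self (norm_pos_iff.2 hv))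
  have hv0 : 0 < ‖tamingField (EM := EM) B μ x₀‖ := norm_pos_iff.2 hv
  refine ⟨((√(B.form (μ x₀) (μ x₀)) + 1) + C₁ + C₂ + (‖tamingField (EM := EM) B μ x₀‖ + 1) + 1 + 1)
    / (‖tamingField (EM := EM) B μ x₀‖ / 2) ^ 2, ?_⟩
  filter_upwards [h₁, h₂, h₃, h₄, h₅] with x hx₁ hx₂ hx₃ hx₄ hx₅
  have hnum := nu_nonneg (B := B) (μ := μ) A (nabla := nabla) x
  have hle : nu B μ A nabla x + 1 ≤
      (√(B.form (μ x₀) (μ x₀)) + 1) + C₁ + C₂ + (‖tamingField (EM := EM) B μ x₀‖ + 1) + 1 + 1 := by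
    unfold nu
    gcongr
  exact div_le_div₀ (by linarith) hle (by positivity) (by gcongr)

theorem IsMomentMapOn.norm_mvfderiv_comp_halfNormSq (hμ : IsMomentMapOn (EM := EM) U μ)
    (hU : IsOpen U) (hM : IsHermitianMetric EM M) {h : ℝ → ℝ} (hh : Differentiable ℝ h) {x : M}
    (hx : x ∈ U) :
    ‖mvfderiv 𝓘(ℝ, EM) (fun y => h (halfNormSq B μ y)) x‖ =
      |deriv h (halfNormSq B μ x)| * ‖tamingField (EM := EM) B μ x‖ := by
  have hc := (hh (halfNormSq B μ x)).hasDerivAt.hasFDerivAt.hasMFDerivAt.comp x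
    (hμ.mdifferentiableAt_halfNormSq (B := B) hU hx).hasMFDerivAt
  have h1 : mvfderiv 𝓘(ℝ, EM) (fun y => h (halfNormSq B μ y)) x =
      deriv h (halfNormSq B μ x) • mvfderiv 𝓘(ℝ, EM) (halfNormSq B μ) x := by
    refine (show mvfderiv 𝓘(ℝ, EM) (fun y => h (halfNormSq B μ y)) x = _ from hc.mfderiv).trans ?_
    ext w
    exact mul_comm (mvfderiv 𝓘(ℝ, EM) (halfNormSq B μ) x w) (deriv h (halfNormSq B μ x))
  have h2 : ‖deriv h (halfNormSq B μ x) • mvfderiv 𝓘(ℝ, EM) (halfNormSq B μ) x‖ =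
      |deriv h (halfNormSq B μ x)| * ‖mvfderiv 𝓘(ℝ, EM) (halfNormSq B μ) x‖ :=
    norm_smul_strongDual _ _
  rw [h1, h2, hM.norm_tamingField]

end LocalBound

end

end TamedKahler

/-! ### Construction of an admissible function dominating κ -/

theorem mainTheorem8
    -- a complete complex manifold with a Riemannian metric
    {EM : Type*} [NormedAddCommGroup EM] [NormedSpace ℂ EM] [FiniteDimensional ℂ EM]
    {M : Type*} [EMetricSpace M] [CompleteSpace M] [ChartedSpace EM M]
    [IsManifold 𝓘(ℂ, EM) ω M]
    [RiemannianBundle (fun x : M => TangentSpace 𝓘(ℝ, EM) x)]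
    [IsContMDiffRiemannianBundle 𝓘(ℝ, EM) ∞ EM (fun x : M => TangentSpace 𝓘(ℝ, EM) x)]
    [IsRiemannianManifold 𝓘(ℝ, EM) M]
    -- a compact Lie group acting smoothly on it
    {EG : Type*} [NormedAddCommGroup EG] [NormedSpace ℝ EG] [FiniteDimensional ℝ EG]
    {G : Type*} [TopologicalSpace G] [ChartedSpace EG G] [Group G] [LieGroup 𝓘(ℝ, EG) ∞ G]
    [CompactSpace G] [MulAction G M] [ContMDiffSMul 𝓘(ℝ, EG) 𝓘(ℝ, EM) ∞ G M]
    -- the moment map and the tameness conditions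
    (B : TamedKahler.InvariantScalarProduct EG G) (μ : M → TamedKahler.LieCoalg EG G)
    (hM : TamedKahler.IsTamed (EM := EM) B μ)
    -- a holomorphic Hermitian equivariant vector bundle with an invariant holomorphic connection
    {FE : Type*} [NormedAddCommGroup FE] [NormedSpace ℂ FE] [FiniteDimensional ℂ FE]
    {E : M → Type*} [TopologicalSpace (TotalSpace FE E)]
    [∀ x, NormedAddCommGroup (E x)] [∀ x, InnerProductSpace ℂ (E x)]
    [FiberBundle FE E] [VectorBundle ℂ FE E] [ContMDiffVectorBundle ω FE E 𝓘(ℂ, EM)]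
    (hE : TamedKahler.IsSmoothHermitianBundle EM FE E)
    (A : TamedKahler.EquivariantStructure EM EG G FE E)
    (nabla : CovariantDerivative 𝓘(ℝ, EM) FE E)
    (hnabla : TamedKahler.IsInvariantHolomorphicConnection A nabla) :
    (TamedKahler.admissible B μ A nabla).Nonempty ∧
    ∀ κ : ℝ → ℝ, MapsTo κ (Ici 0) (Ici 0) → (∀ T : ℝ, BddAbove (κ '' Icc 0 T)) →
      ∃ s ∈ TamedKahler.admissible B μ A nabla,
        ∀ t : ℝ, 0 < t → κ t ≤ s t ∧ κ t ≤ derivWithin s (Ici 0) t := by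
  have hmain : ∀ κ : ℝ → ℝ, MapsTo κ (Ici 0) (Ici 0) → (∀ T : ℝ, BddAbove (κ '' Icc 0 T)) →
      ∃ s ∈ TamedKahler.admissible B μ A nabla,
        ∀ t : ℝ, 0 < t → κ t ≤ s t ∧ κ t ≤ derivWithin s (Ici 0) t := by
    intro κ hκ hκb
    have := Manifold.locallyCompact_of_finiteDimensional (M := M) 𝓘(ℝ, EM)
    obtain ⟨K, hK, -, -, -, hμ⟩ := hM.asymptotically_hamiltonian
    obtain ⟨K', hK', hv⟩ := hM.nonvanishing
    have hU : IsOpen Kᶜ := hK.isClosed.isOpen_compl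
    have hφ : Tendsto (TamedKahler.halfNormSq B μ) (cocompact M) atTop :=
      B.tendsto_form_self.comp hM.proper
    have hφ0 : ∀ x, 0 ≤ TamedKahler.halfNormSq B μ x := fun x =>
      div_nonneg (B.form_self_nonneg (μ x)) zero_le_two
    obtain ⟨b, hb⟩ := TamedKahler.exists_le_of_locally_bounded hφ (hK.union hK') fun x hx =>
      hμ.exists_nu_div_le (B := B) A hU hE.hasContinuousNorm hnabla.smooth
        (fun h => hx (Or.inl h)) (hv x fun h => hx (Or.inr h))
    -- Bounding κ up to n + 2 leaves one unit for the floor and one for the shift from t to t - 1 in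
    -- the lower bound on `s`.
    choose k hk using fun n : ℕ => hκb (n + 2)
    have hk' : ∀ (n : ℕ) (t : ℝ), 0 ≤ t → t ≤ n + 2 → κ t ≤ k n := fun n t h0 ht =>
      hk n ⟨t, ⟨h0, ht⟩, rfl⟩
    -- The three entries give h ≥ 1, domination of (⌊φ⌋+1)(ν+1)/|v|², and domination of κ.
    obtain ⟨h, hh, hh0, hhb, hhd⟩ := TamedKahler.exists_contDiff_growth fun n =>
      max 1 (max ((n + 1) * b n) (k n))
    -- The additive constant is `k 0`, a bound for κ on [0, 2], nonnegative because κ(0) ≥ 0.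
    obtain ⟨s, hs, hs0, hsd, hsa, hsc⟩ := TamedKahler.exists_primitive hh hh0
      ((hκ (mem_Ici.2 (le_refl (0 : ℝ)))).trans (hk' 0 0 le_rfl (by norm_num)))
    refine ⟨s, ⟨hs, hs0, fun r hr => by rw [hsd r hr]; exact hh0 r, ?_⟩, fun t ht => ⟨?_, ?_⟩⟩
    · intro f v
      have hf : f = fun x => h (TamedKahler.halfNormSq B μ x) := funext fun x => hsd _ (hφ0 x)
      rw [hf]
      refine TamedKahler.tendsto_growth_quotient (D := fun x => ‖mvfderiv 𝓘(ℝ, EM)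
        (fun y => h (TamedKahler.halfNormSq B μ y)) x‖) (V := fun x => ‖v x‖) hφ ?_
        (Eventually.of_forall (TamedKahler.nu_nonneg A)) (fun _ => ContinuousLinearMap.opNorm_nonneg _) ?_ hh0
        (Eventually.of_forall fun x => (le_max_left _ _).trans (hhb _ (hφ0 x) _ le_rfl)) ?_ hhd
      · filter_upwards [hK'.compl_mem_cocompact] with x hx
        exact norm_pos_iff.2 (hv x hx)
      · filter_upwards [hK.compl_mem_cocompact] with x hx
        exact (hμ.norm_mvfderiv_comp_halfNormSq hU hM.hermitian (hh.differentiable (by simp))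
          hx).le
      · filter_upwards [hb] with x hx
        exact (mul_le_mul_of_nonneg_left hx (by positivity)).trans
          (((le_max_left _ _).trans (le_max_right _ _)).trans (hhb _ (hφ0 x) _ le_rfl))
    · rcases le_or_gt t 2 with h2 | h2
      · exact (hk' 0 t ht.le (by simpa using h2)).trans (hsa t ht.le)
      -- On [t - 1, t] the function `h` is at least k(⌊t⌋ - 1), which bounds κ on [0, ⌊t⌋ + 1] and
      -- so at t.
      · refine hsc t _ (by linarith) fun r hr => ?_
        have hle : ⌊t⌋₊ - 1 ≤ ⌊r⌋₊ := by
          rw [← Nat.floor_sub_one]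
          exact Nat.floor_mono hr.1
        have h1 : 1 ≤ ⌊t⌋₊ := (Nat.one_le_floor_iff t).2 (by linarith)
        refine (hk' (⌊t⌋₊ - 1) t ht.le ?_).trans (((le_max_right _ _).trans
          (le_max_right _ _)).trans (hhb r (by linarith [hr.1]) _ hle))
        push_cast [h1]
        linarith [Nat.lt_floor_add_one t]
    · rw [hsd t ht.le]
      refine (hk' ⌊t⌋₊ t ht.le ?_).trans (((le_max_right _ _).trans
        (le_max_right _ _)).trans (hhb t ht.le _ le_rfl))
      linarith [Nat.lt_floor_add_one t]
  refine ⟨?_, hmain⟩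
  obtain ⟨s, hs, -⟩ := hmain 0 (fun _ _ => mem_Ici.2 le_rfl) fun T => ⟨0, by
    rintro _ ⟨t, -, rfl⟩
    rfl⟩
  exact ⟨s, hs⟩
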